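/- Let $\phi:\mathbb{R}\to[0,\infty)$ be even, nonincreasing on $(0,\infty)$ and locally integrable, and set $\Phi(x)=\int_0^x\phi$, $W_\Phi(x)=\int_0^x\Phi$. Let $\Omega=(0,1)$, let $\mathscr{K}\subset L^2(\Omega)$ be the cone of (classes of) nondecreasing right-continuous functions, with indicator function $I_{\mathscr K}$ ($0$ on $\mathscr K$, $+\infty$ elsewhere), and let $\partial$ denote the subdifferential in $L^2(\Omega)$ and $\mathrm{P}_{C}$ the metric projection onto $C\subset L^2(\Omega)$. For $X\in\mathscr K$ let $\Omega_X$ be the set of $m\in\Omega$ such that $X$ is constant in a neighbourhood of $m$, and $\mathscr{H}_X$ the space of $U\in L^2(\Omega)$ that are constant on each interval contained in $\Omega_X$. Write $\Phi*\rho(X)=\int_\Omega\Phi(X-X(\omega))\,d\omega$ (here $\rho=X_\#\mathcal{L}^1|_\Omega$), $\Psi[X,V]=V+\Phi*\rho(X)$. Given $\bar X\in\mathscr K$, $\bar V\in L^2(\Omega)$ and $\bar\Psi=\Psi[\bar X,\bar V]$, let $U[X]=\bar\Psi-\Phi*\rho(X)$ and $\bar{\mathcal V}(X)=\frac12\iint_{\Omega\times\Omega}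 W_\Phi(X(m)-X(\omega))\,d\omega\,dm-\langle\bar\Psi,X\rangle+I_{\mathscr K}(X)$. A Lagrangian solution with data $(\bar X,\bar V)$ is a (locally) absolutely continuous curve $X:[0,\infty)\to\mathscr K\subset L^2(\Omega)$ with $X_0=\bar X$ such that, for a.e. $t>0$, $-\dot X_t$ is the element of minimal norm of $\partial\bar{\mathcal V}(X_t)$. It is sticky if $\Omega_{X_s}\subset\Omega_{X_t}$ for all $0\le s\le t$. Let $m_1,\dots,m_N>0$ with $\sum_i m_i=1$, let $\bar x_1<\dots<\bar x_N$ and $\bar v\in\mathbb{R}^N$. A sticky particle solution with these data is a pair $(x(t),v(t))\in\mathbb{R}^N\times\mathbb{R}^N$, $t\ge0$, with $(x(0),v(0))=(\bar x,\bar v)$, such that $x$ is continuous, $x_1(t)\le\dots\le x_N(t)$, $v(t)$ is the right derivative of $x$ at $t$ for every $t\ge0$, and: there are finitely many collision times, a collision time being a $t>0$ at which some two particles are at the same place without having been so throughout some interval $(t-\varepsilon,t)$, $\varepsilon>0$; $\psi_i=v_i+\sum_j m_j\Phi(x_i-x_j)$ is constant for each $i$ between collisions, that is, on every interval $[a,b]\subset[0,\infty)$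 with no collision time in $(a,b]$; at each collision time $t$ the left limit $v(t-)$ exists and $v(t)$ is its projection, in the norm $(\sum_i m_i|\cdot_i|^2)^{1/2}$, onto the tangent cone at $x(t)$ of $\mathbb{K}^N=\{y\in\mathbb{R}^N: y_1\le\dots\le y_N\}$ (perfectly inelastic collisions). Let $(x,v)$ be such a solution. With $\theta_0=0$, $\theta_i=\sum_{j\le i}m_j$, set $$X_t=\sum_{i=1}^N x_i(t)\chi_{[\theta_{i-1},\theta_i)},\quad V_t=\sum_{i=1}^N v_i(t)\chi_{[\theta_{i-1},\theta_i)},\quad \bar X=X_0,\ \bar V=V_0,\ \bar\Psi=\Psi[\bar X,\bar V],\ \Psi_t=\Psi[X_t,V_t].$$ **Proposition.** $X$ is a sticky Lagrangian solution with data $(\bar X,\bar V)$. In particular $$\dot X_t+\partial I_{\mathscr K}(X_t)\ni\bar\Psi-\Phi*\rho_t(X_t)\quad\text{for a.e. }t>0,\qquad \rho_t=X_{t\#}\mathcal{L}^1|_\Omega;$$ for every $t\ge0$, $V_t$ is the right derivative of $X$ at $t$ in $L^2(\Omega)$, and the inclusion holds with $V_t$ in place of $\dot X_t$. Moreover, for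 all $0\le s\le t$, $$V_t,\Psi_t\in\mathscr H_{X_t},\qquad \Psi_s-\Psi_t\in\partial I_{\mathscr K}(X_t),\qquad \Psi_t=\mathrm P_{\mathscr H_{X_t}}\Psi_s,$$ $$X_t=\mathrm P_{\mathscr K}\Big(X_s+(t-s)\Psi_s-\int_s^t\Phi*\rho_r(X_r)\,dr\Big),$$ $$V_t=\mathrm P_{\mathscr H_{X_t}}U[X_t]=\mathrm P_{\mathscr H_{X_t}}\bar\Psi-\Phi*\rho_t(X_t),\qquad \Psi_t=\mathrm P_{\mathscr H_{X_t}}\bar\Psi,$$ $$X_t=\mathrm P_{\mathscr K}\Big(\bar X+\int_0^tU[X_r]\,dr\Big)=\mathrm P_{\mathscr K}\Big(\bar X+t\bar\Psi-\int_0^t\Phi*\rho_r(X_r)\,dr\Big),$$ where the integrals are Bochner integrals in $L^2(\Omega)$ of integrable functions. -/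

import Mathlib

open MeasureTheory Set Filter Topology

noncomputable section

namespace StickyParticles

/-! ### Communication protocols -/

/-- A communication protocol: even, nonnegative, radially nonincreasing (possibly singular at `0`)
and locally integrable. -/
structure IsProtocol (φ : ℝ → ℝ) : Prop where
  even : ∀ x, φ (-x) = φ x
  nonneg : ∀ x, 0 ≤ φ x
  antitone : AntitoneOn φ (Ioi 0)
  locInt : LocallyIntegrable φ volume

/-- The odd primitive `Φ(x) = ∫₀ˣ φ`. -/
def primPhi (φ : ℝ → ℝ) (x : ℝ) : ℝ := ∫ y in (0 : ℝ)..x, φ y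

/-- The even primitive `W_Φ(x) = ∫₀ˣ Φ`. -/
def primW (φ : ℝ → ℝ) (x : ℝ) : ℝ := ∫ y in (0 : ℝ)..x, primPhi φ y

theorem IsProtocol.intervalIntegrable {φ : ℝ → ℝ} (hφ : IsProtocol φ) (a b : ℝ) :
    IntervalIntegrable φ volume a b :=
  (hφ.locInt.integrableOn_isCompact isCompact_uIcc).intervalIntegrable

theorem continuous_primPhi {φ : ℝ → ℝ} (hφ : IsProtocol φ) : Continuous (primPhi φ) :=
  intervalIntegral.continuous_primitive (fun a b => hφ.intervalIntegrable a b) 0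

theorem primPhi_neg {φ : ℝ → ℝ} (hφ : IsProtocol φ) (x : ℝ) :
    primPhi φ (-x) = -primPhi φ x := by
  have h := intervalIntegral.integral_comp_neg (a := 0) (b := x) φ
  simp only [hφ.even, neg_zero] at h
  unfold primPhi
  rw [h, intervalIntegral.integral_symm]

theorem abs_primPhi_le_of_nonneg {φ : ℝ → ℝ} (hφ : IsProtocol φ) {x : ℝ} (hx : 0 ≤ x) :
    |primPhi φ x| ≤ primPhi φ 1 + φ 1 * |x| := by
  have hnn : 0 ≤ primPhi φ x :=
    intervalIntegral.integral_nonneg hx (fun y _ => hφ.nonneg y)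
  have hadd : primPhi φ x + ∫ y in x..1, φ y = primPhi φ 1 :=
    intervalIntegral.integral_add_adjacent_intervals
      (hφ.intervalIntegrable 0 x) (hφ.intervalIntegrable x 1)
  rw [abs_of_nonneg hnn, abs_of_nonneg hx]
  have h1 := hφ.nonneg 1
  rcases le_total x 1 with h | h
  · have : 0 ≤ ∫ y in x..1, φ y :=
      intervalIntegral.integral_nonneg h (fun y _ => hφ.nonneg y)
    nlinarith [mul_nonneg h1 hx]
  · have h2 : ∫ y in (1 : ℝ)..x, φ y ≤ ∫ _ in (1 : ℝ)..x, φ 1 :=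
      intervalIntegral.integral_mono_on h (hφ.intervalIntegrable 1 x)
        intervalIntegrable_const
        (fun y hy => hφ.antitone (by simp) (lt_of_lt_of_le one_pos hy.1) hy.1)
    rw [intervalIntegral.integral_const, smul_eq_mul] at h2
    rw [intervalIntegral.integral_symm] at hadd
    nlinarith

theorem abs_primPhi_le {φ : ℝ → ℝ} (hφ : IsProtocol φ) (x : ℝ) :
    |primPhi φ x| ≤ primPhi φ 1 + φ 1 * |x| := by
  rcases le_total 0 x with h | h
  · exact abs_primPhi_le_of_nonneg hφ h
  · have := abs_primPhi_le_of_nonneg hφ (neg_nonneg.mpr h)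
    rwa [primPhi_neg hφ, abs_neg, abs_neg] at this

/-! ### The space `L²(Ω)`, `Ω = (0,1)`, and convex analysis in it -/

/-- Lebesgue measure on `Ω = (0,1)`. -/
abbrev μΩ : Measure ℝ := volume.restrict (Ioo (0 : ℝ) 1)

/-- `L²(Ω)`. -/
abbrev L2Ω : Type := Lp ℝ 2 μΩ

/-- The cone `𝒦` of classes with a nondecreasing right-continuous representative on `Ω`. -/
def coneK : Set L2Ω :=
  {X | ∃ f : ℝ → ℝ, MonotoneOn f (Ioo 0 1) ∧
    (∀ m ∈ Ioo (0 : ℝ) 1, ContinuousWithinAt f (Ici m) m) ∧ (X : ℝ → ℝ) =ᵐ[μΩ] f}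

/-- `Ω_X`: the points of `Ω` in a neighbourhood of which `X` is (a.e. equal to a) constant. -/
def OmegaSet (X : L2Ω) : Set ℝ :=
  {m | m ∈ Ioo (0 : ℝ) 1 ∧ ∃ c : ℝ, ∃ O ∈ 𝓝 m, ∀ᵐ y ∂μΩ, y ∈ O → X y = c}

/-- `ℋ_X`: the functions that are constant on each interval contained in `Ω_X`. -/
def spaceH (X : L2Ω) : Set L2Ω :=
  {U | ∀ a b : ℝ, a < b → Ioo a b ⊆ OmegaSet X →
    ∃ c : ℝ, ∀ᵐ y ∂volume.restrict (Ioo a b), U y = c}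

/-- The subdifferential of an extended-real-valued functional on `L²(Ω)`. -/
def subdiff (F : L2Ω → EReal) (X : L2Ω) : Set L2Ω :=
  {Y | ∀ Z : L2Ω, F X + ((inner ℝ Y (Z - X) : ℝ) : EReal) ≤ F Z}

open Classical in
/-- The indicator function `I_𝒦`. -/
def indK (X : L2Ω) : EReal := if X ∈ coneK then 0 else ⊤

/-- `Y` is the metric projection of `Z` onto `C`. -/
def IsMetricProj (C : Set L2Ω) (Z Y : L2Ω) : Prop :=
  Y ∈ C ∧ ∀ W ∈ C, ‖Z - Y‖ ≤ ‖Z - W‖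

/-- `Y` is the element of minimal norm of `C`. -/
def IsMinimalElement (C : Set L2Ω) (Y : L2Ω) : Prop :=
  Y ∈ C ∧ ∀ W ∈ C, ‖Y‖ ≤ ‖W‖

theorem memLp_affine_abs {μ : Measure ℝ} [IsProbabilityMeasure μ]
    {f : ℝ → ℝ} (hf : MemLp f 2 μ) (C c : ℝ) : MemLp (fun m => C + c * |f m|) 2 μ := by
  have h1 : MemLp (fun m => |f m|) 2 μ := hf.norm
  exact (memLp_const C).add (h1.const_mul c)

theorem aestronglyMeasurable_conv {Φ : ℝ → ℝ} (h : Continuous Φ) {μ : Measure ℝ} [IsProbabilityMeasure μ]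
    {f : ℝ → ℝ} (hf : AEStronglyMeasurable f μ)  :
    AEStronglyMeasurable (fun m => ∫ ω, Φ (f m - f ω) ∂μ) μ := by
  have h : AEStronglyMeasurable (fun p : ℝ × ℝ => Φ (f p.1 - f p.2)) (μ.prod μ) :=
      h.comp_aestronglyMeasurable
        ((hf.comp_fst).sub (hf.comp_snd))
  exact h.integral_prod_right'

theorem norm_conv_le {Φ : ℝ → ℝ} {μ : Measure ℝ} [IsProbabilityMeasure μ]
    {f : ℝ → ℝ} (hfi : Integrable f μ) (C c : ℝ) (hc : 0 ≤ c) (hb : ∀ x, |Φ x| ≤ C + c * |x|) (m : ℝ) :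
    ‖∫ ω, Φ (f m - f ω) ∂μ‖ ≤ (∫ ω, (C + c * |f ω|) ∂μ) + c * |f m| := by
  have h1 : Integrable (fun ω => |f ω|) μ := hfi.norm
  have hi : Integrable (fun ω => C + c * |f ω|) μ := (integrable_const _).add (h1.const_mul _)
  have hi2 : Integrable (fun ω => (C + c * |f ω|) + c * |f m|) μ := hi.add (integrable_const _)
  have h0 : ∀ ω, ‖Φ (f m - f ω)‖ ≤ (C + c * |f ω|) + c * |f m| := by
    intro ω
    rw [Real.norm_eq_abs]
    have h2 : |f m - f ω| ≤ |f m| + |f ω| := abs_sub _ _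
    have h3 := mul_le_mul_of_nonneg_left h2 hc
    linarith [hb (f m - f ω)]
  calc ‖∫ ω, Φ (f m - f ω) ∂μ‖ ≤ ∫ ω, ((C + c * |f ω|) + c * |f m|) ∂μ :=
        norm_integral_le_of_norm_le hi2 (Eventually.of_forall h0)
    _ = _ := by rw [integral_add hi (integrable_const _)]; simp

theorem isProbabilityMeasure_μΩ : IsProbabilityMeasure μΩ :=
  ⟨by simp⟩

theorem memLp_conv {φ : ℝ → ℝ} (hφ : IsProtocol φ) (X : L2Ω) :
    MemLp (fun m => ∫ ω, primPhi φ (X m - X ω) ∂μΩ) 2 μΩ :=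
  haveI := isProbabilityMeasure_μΩ
  (memLp_affine_abs (Lp.memLp X) (∫ ω, (primPhi φ 1 + φ 1 * |X ω|) ∂μΩ) (φ 1)).mono'
    (aestronglyMeasurable_conv (continuous_primPhi hφ) (Lp.memLp X).1)
    (Eventually.of_forall fun m => norm_conv_le ((Lp.memLp X).integrable (by norm_num))
      (primPhi φ 1) (φ 1) (hφ.nonneg 1) (abs_primPhi_le hφ) m)

/-- `Φ∗ρ(X)` with `ρ = X_# 𝔪`, that is `m ↦ ∫_Ω Φ(X(m) - X(ω)) dω`, as an element of `L²(Ω)`. -/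
def PhiConv {φ : ℝ → ℝ} (hφ : IsProtocol φ) (X : L2Ω) : L2Ω := (memLp_conv hφ X).toLp

/-- `Ψ[X,V] = V + Φ∗ρ(X)`. -/
def PsiOf {φ : ℝ → ℝ} (hφ : IsProtocol φ) (X V : L2Ω) : L2Ω := V + PhiConv hφ X

/-- The prescribed velocity `U[X] = Ψ̄ - Φ∗ρ(X)`. -/
def UOf {φ : ℝ → ℝ} (hφ : IsProtocol φ) (Ψbar X : L2Ω) : L2Ω := Ψbar - PhiConv hφ X

/-- The potential `𝒱(X) = ½ ∬ W_Φ(X(m) - X(ω)) dω dm - ⟨Ψ̄, X⟩`. -/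
def potential (φ : ℝ → ℝ) (Ψbar X : L2Ω) : ℝ :=
  (1 / 2) * (∫ m, ∫ ω, primW φ (X m - X ω) ∂μΩ ∂μΩ) - inner ℝ Ψbar X

/-- The potential restricted to the cone, `𝒱 + I_𝒦`. -/
def potentialK (φ : ℝ → ℝ) (Ψbar X : L2Ω) : EReal := (potential φ Ψbar X : EReal) + indK X

/-! ### Lagrangian solutions -/

/-- A Lagrangian solution with data `(X̄, V̄)`: a (locally) absolutely continuous curve
`[0,∞) → 𝒦 ⊆ L²(Ω)` starting at `X̄` that is an `L²`-gradient flow of `𝒱 + I_𝒦`, with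
`Ψ̄ = Ψ[X̄,V̄]`, evolving along the minimal selection of the subdifferential. Only the values of the
curve at times `t ≥ 0` matter. -/
structure IsLagrangianSolution {φ : ℝ → ℝ} (hφ : IsProtocol φ) (Xbar Vbar : L2Ω)
    (X : ℝ → L2Ω) : Prop where
  init : X 0 = Xbar
  mem : ∀ t, 0 ≤ t → X t ∈ coneK
  ac : ∀ T, 0 < T → AbsolutelyContinuousOnInterval X 0 T
  flow : ∀ᵐ t ∂volume.restrict (Ioi (0 : ℝ)), ∃ D : L2Ω, HasDerivAt X D t ∧
    IsMinimalElement (subdiff (potentialK φ (PsiOf hφ Xbar Vbar)) (X t)) (-D)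

/-- A sticky Lagrangian solution. -/
structure IsStickyLagrangianSolution {φ : ℝ → ℝ} (hφ : IsProtocol φ) (Xbar Vbar : L2Ω)
    (X : ℝ → L2Ω) : Prop extends IsLagrangianSolution hφ Xbar Vbar X where
  sticky : ∀ s t, 0 ≤ s → s ≤ t → OmegaSet (X s) ⊆ OmegaSet (X t)

/-! ### Sticky particles -/

/-- The tangent cone at `x` to the cone of nondecreasing vectors of `ℝᴺ`. -/
def tangentCone {N : ℕ} (x : Fin N → ℝ) : Set (Fin N → ℝ) :=
  closure {w | ∃ ϑ : ℝ, 0 ≤ ϑ ∧ ∃ y : Fin N → ℝ, Monotone y ∧ w = ϑ • (y - x)}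

/-- `w` is the projection of `u` onto `C` for the `m`-weighted Euclidean norm of `ℝᴺ`. -/
def IsWeightedProj {N : ℕ} (m : Fin N → ℝ) (C : Set (Fin N → ℝ)) (u w : Fin N → ℝ) : Prop :=
  w ∈ C ∧ ∀ z ∈ C, ∑ i, m i * (u i - w i) ^ 2 ≤ ∑ i, m i * (u i - z i) ^ 2

/-- `ψ_i = v_i + ∑_j m_j Φ(x_i - x_j)`. -/
def psi (φ : ℝ → ℝ) {N : ℕ} (m x v : Fin N → ℝ) (i : Fin N) : ℝ :=
  v i + ∑ j, m j * primPhi φ (x i - x j)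

/-- Two particles meet at time `t > 0`: they are at the same place at time `t`, but not throughout
any time interval just before `t`. -/
def IsCollisionTime {N : ℕ} (x : ℝ → Fin N → ℝ) (t : ℝ) : Prop :=
  0 < t ∧ ∃ i j, x t i = x t j ∧ ∃ᶠ s in 𝓝[<] t, x s i ≠ x s j

/-- The particle dynamics with perfectly inelastic collisions, on the time interval `[0,∞)`: the
trajectories are continuous and ordered and have right derivative `v`; there are finitely many
collision times; between collisions the particles follow the integrated Cucker-Smale system, that
is, each `ψ_i` is constant (up to and excluding the next collision time, so that `v` is
right-continuous); at a collision time `t` the velocity `v(t) = v(t+)` is the projection of the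
left limit `v(t-)` onto the tangent cone at `x(t)`. That particles which have met stay together is
a consequence, not a requirement. -/
structure IsStickyParticleSolution (φ : ℝ → ℝ) {N : ℕ} (m xbar vbar : Fin N → ℝ)
    (x v : ℝ → Fin N → ℝ) : Prop where
  init_pos : x 0 = xbar
  init_vel : v 0 = vbar
  ordered : ∀ t, 0 ≤ t → Monotone (x t)
  cont : ContinuousOn x (Ici 0)
  deriv_right : ∀ t, 0 ≤ t → HasDerivWithinAt x (v t) (Ici t) t
  finite_coll : {t | IsCollisionTime x t}.Finite
  free : ∀ a b, 0 ≤ a → a ≤ b → (∀ t ∈ Ioc a b, ¬ IsCollisionTime x t) →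
    ∀ i, psi φ m (x b) (v b) i = psi φ m (x a) (v a) i
  collision : ∀ t, IsCollisionTime x t →
    ∃ vm : Fin N → ℝ, Tendsto v (𝓝[<] t) (𝓝 vm) ∧
      IsWeightedProj m (tangentCone (x t)) vm (v t)

/-- The step function `∑ i, a_i χ_{[θ_{i-1}, θ_i)}`, where `θ_i = ∑_{j ≤ i} m_j`. -/
def stepFun {N : ℕ} (m a : Fin N → ℝ) (s : ℝ) : ℝ :=
  ∑ i, (Ico (∑ j ∈ Finset.Iio i, m j) (∑ j ∈ Finset.Iic i, m j)).indicator (fun _ => a i) s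

theorem memLp_stepFun {N : ℕ} (m a : Fin N → ℝ) : MemLp (stepFun m a) 2 μΩ := by
  unfold stepFun
  exact memLp_finsetSum _ fun i _ =>
    memLp_indicator_const 2 measurableSet_Ico (a i) (Or.inr (measure_ne_top _ _))

/-- The step function as an element of `L²(Ω)`. -/
def step {N : ℕ} (m a : Fin N → ℝ) : L2Ω := (memLp_stepFun m a).toLp

end StickyParticles

end

open StickyParticles

/-! The map `step m` embeds `ℝᴺ` with the `m`-weighted inner product isometrically into `L²(Ω)`, and
pairing a step function with any `U` sees only the cell means of `U` (`inner_step`). The cell means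
of an element of `𝒦` form a monotone vector (`cellMean_monotone`), and those of an element of `ℋ_X`
are equal on particles at the same place (`cellMean_constOnClusters`). Statements quantified over
`𝒦` or `ℋ_X` thus reduce to finite sums.

The dynamical core is that `ψ(s) - ψ(t)` lies in the polar of the tangent cone at `x(t)` whenever `s
≤ t` (`sum_psi_sub_nonpos`). Indeed `ψ` changes only at collisions, and there its jump is the
residual of a projection onto the tangent cone at that time. The tangent cones decrease in time
because particles that have met stay together, so the jumps can be added and tested against the last
cone.

That particles stay together has two causes. Particles about to meet have velocities nonincreasing
in the index, and the inelastic projection makes such velocities equal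
(`IsWeightedProj.constOnClusters`). Afterwards their `ψ` agree, and since `Φ` is nondecreasing the
gap between them cannot grow (`exists_Icc_eq`).

The rest is convex analysis. Polarity to the tangent cone gives membership in the subdifferential of
`I_𝒦`. Cluster-constant vectors form a linear subspace of that cone, so polarity also gives
orthogonality to `ℋ_X`, hence the projections onto `ℋ_X`. Integrating the polar inequality in time
gives the projection formula for positions. Convexity of the potential together with `Ψ̄ - Ψ_t ⊥
V_t` identifies `-V_t` as the minimal selection. -/

noncomputable section

namespace StickyParticles

/-! ### Step functions -/

section Cells

variable {N : ℕ} {m : Fin N → ℝ}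

/-- The left endpoint of the `i`-th cell. -/
def cellLeft (m : Fin N → ℝ) (i : Fin N) : ℝ := ∑ j ∈ Finset.Iio i, m j

/-- The right endpoint of the `i`-th cell. -/
def cellRight (m : Fin N → ℝ) (i : Fin N) : ℝ := ∑ j ∈ Finset.Iic i, m j

theorem cellRight_eq (m : Fin N → ℝ) (i : Fin N) : cellRight m i = cellLeft m i + m i := by
  unfold cellRight cellLeft
  rw [← Finset.Iio_insert, Finset.sum_insert (by simp), add_comm]

theorem cellLeft_lt_cellRight (hm : ∀ i, 0 < m i) (i : Fin N) : cellLeft m i < cellRight m i := by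
  rw [cellRight_eq]; linarith [hm i]

theorem cellRight_le_cellLeft (hm : ∀ i, 0 < m i) {i j : Fin N} (h : i < j) :
    cellRight m i ≤ cellLeft m j := by
  refine Finset.sum_le_sum_of_subset_of_nonneg ?_ fun k _ _ => (hm k).le
  intro k hk
  simp only [Finset.mem_Iic, Finset.mem_Iio] at *
  exact lt_of_le_of_lt hk h

theorem cellLeft_nonneg (hm : ∀ i, 0 < m i) (i : Fin N) : 0 ≤ cellLeft m i :=
  Finset.sum_nonneg fun k _ => (hm k).le

theorem cellRight_le_one (hm : ∀ i, 0 < m i) (hs : ∑ i, m i = 1) (i : Fin N) :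
    cellRight m i ≤ 1 := by
  rw [← hs]
  exact Finset.sum_le_sum_of_subset_of_nonneg (Finset.subset_univ _) fun k _ _ => (hm k).le

theorem exists_mem_cell (hs : ∑ i, m i = 1) {y : ℝ} (hy : y ∈ Ico (0 : ℝ) 1) :
    ∃ i, y ∈ Ico (cellLeft m i) (cellRight m i) := by
  obtain ⟨n, rfl⟩ : ∃ n, N = n + 1 := by
    rcases N with _ | n
    · simp at hs
    · exact ⟨n, rfl⟩
  have h0 : ∃ i, y < cellRight m i := by
    refine ⟨Fin.last n, ?_⟩
    have : (Finset.Iic (Fin.last n)) = Finset.univ := by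
      ext k; simp [Fin.le_last]
    rw [cellRight, this, hs]
    exact hy.2
  let S : Finset (Fin (n + 1)) := Finset.univ.filter fun i => y < cellRight m i
  have hS : S.Nonempty := by
    obtain ⟨i, hi⟩ := h0
    exact ⟨i, by simp [S, hi]⟩
  have hmin := S.min'_mem hS
  set i := S.min' hS with hi
  refine ⟨i, ?_, by simpa [S] using hmin⟩
  rcases Fin.eq_zero_or_eq_succ i with h | ⟨k, h⟩
  · have : (Finset.Iio (0 : Fin (n + 1))) = ∅ := by ext k; simp
    rw [h, cellLeft, this, Finset.sum_empty]
    exact hy.1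
  -- The index is the least one whose right endpoint exceeds `y`. Its predecessor therefore fails
  -- this, and the predecessor's right endpoint is the left endpoint of the cell found.
  · have hk : k.castSucc ∉ S := fun hk => by
      have h1 := S.min'_le _ hk
      rw [← hi, h] at h1
      exact absurd h1 (not_le.mpr Fin.castSucc_lt_succ)
    have h2 : (Finset.Iio k.succ) = Finset.Iic k.castSucc := by
      ext j; simp [Fin.lt_def, Fin.le_def]
    rw [h, cellLeft, h2]
    exact not_lt.mp fun h3 => hk (Finset.mem_filter.mpr ⟨Finset.mem_univ _, h3⟩)

theorem stepFun_eq (hm : ∀ i, 0 < m i) (a : Fin N → ℝ) {i : Fin N} {y : ℝ}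
    (hy : y ∈ Ico (cellLeft m i) (cellRight m i)) : stepFun m a y = a i := by
  unfold stepFun
  rw [Finset.sum_eq_single i]
  · exact indicator_of_mem hy _
  · intro j _ hj
    refine indicator_of_notMem (fun hy' => ?_) _
    have h' : y ∈ Ico (cellLeft m j) (cellRight m j) := hy'
    rcases lt_or_gt_of_ne hj with h | h
    · linarith [cellRight_le_cellLeft hm h, h'.2, hy.1]
    · linarith [cellRight_le_cellLeft hm h, h'.1, hy.2]
  · simp

theorem index_le (hm : ∀ i, 0 < m i) {i j : Fin N} {y z : ℝ}
    (hy : y ∈ Ico (cellLeft m i) (cellRight m i)) (hz : z ∈ Ico (cellLeft m j) (cellRight m j))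
    (hyz : y ≤ z) : i ≤ j := by
  by_contra h
  linarith [cellRight_le_cellLeft hm (not_le.mp h), hy.1, hz.2]

theorem monotoneOn_stepFun (hm : ∀ i, 0 < m i) (hs : ∑ i, m i = 1) {a : Fin N → ℝ}
    (ha : Monotone a) : MonotoneOn (stepFun m a) (Ico 0 1) := by
  intro y hy z hz hyz
  obtain ⟨i, hi⟩ := exists_mem_cell hs hy
  obtain ⟨j, hj⟩ := exists_mem_cell hs hz
  rw [stepFun_eq hm a hi, stepFun_eq hm a hj]
  exact ha (index_le hm hi hj hyz)

theorem stepFun_comp (hm : ∀ i, 0 < m i) (hs : ∑ i, m i = 1) (F : ℝ → ℝ) (a : Fin N → ℝ) {y : ℝ}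
    (hy : y ∈ Ico (0 : ℝ) 1) : F (stepFun m a y) = stepFun m (fun i => F (a i)) y := by
  obtain ⟨i, hi⟩ := exists_mem_cell hs hy
  rw [stepFun_eq hm _ hi, stepFun_eq hm _ hi]

theorem coeFn_step (m a : Fin N → ℝ) : (step m a : ℝ → ℝ) =ᵐ[μΩ] stepFun m a :=
  (memLp_stepFun m a).coeFn_toLp

theorem step_mem_coneK (hm : ∀ i, 0 < m i) (hs : ∑ i, m i = 1) {a : Fin N → ℝ}
    (ha : Monotone a) : step m a ∈ coneK := by
  refine ⟨stepFun m a, (monotoneOn_stepFun hm hs ha).mono Ioo_subset_Ico_self, ?_, coeFn_step m a⟩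
  intro y hy
  obtain ⟨i, hi⟩ := exists_mem_cell hs (Ioo_subset_Ico_self hy)
  have h : stepFun m a =ᶠ[𝓝[Ici y] y] fun _ => a i := by
    filter_upwards [self_mem_nhdsWithin, mem_nhdsWithin_of_mem_nhds (Iio_mem_nhds hi.2)]
      with z hz hz'
    exact stepFun_eq hm a ⟨hi.1.trans hz, hz'⟩
  exact continuousWithinAt_const.congr_of_eventuallyEq h (stepFun_eq hm a hi)

/-- `a ↦ step m a` as a linear map. -/
def stepₗ (m : Fin N → ℝ) : (Fin N → ℝ) →ₗ[ℝ] L2Ω where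
  toFun := step m
  map_add' a b := by
    unfold step
    rw [← MemLp.toLp_add]
    congr 1
    ext y
    simp only [stepFun, Pi.add_apply, ← Finset.sum_add_distrib, indicator_add]
  map_smul' c a := by
    unfold step
    rw [RingHom.id_apply, ← MemLp.toLp_const_smul]
    congr 1
    ext y
    simp only [stepFun, Pi.smul_apply, Finset.smul_sum]
    refine Finset.sum_congr rfl fun i _ => ?_
    exact indicator_const_smul_apply _ c (fun _ => a i) y

/-- `a ↦ step m a` as a continuous linear map. -/
def stepL (m : Fin N → ℝ) : (Fin N → ℝ) →L[ℝ] L2Ω := LinearMap.toContinuousLinearMap (stepₗ m)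

@[simp] theorem stepL_apply (m a : Fin N → ℝ) : stepL m a = step m a := rfl

/-! ### Cell means and pairings with step functions -/

/-- The first half-open cell contains `0`, which is outside `Ω`. The two sets therefore agree only
up to a null set. -/
theorem restrict_cell (hm : ∀ i, 0 < m i) (hs : ∑ i, m i = 1) (i : Fin N) :
    μΩ.restrict (Ico (cellLeft m i) (cellRight m i))
      = volume.restrict (Ioo (cellLeft m i) (cellRight m i)) := by
  rw [Measure.restrict_restrict measurableSet_Ico]
  refine Measure.restrict_congr_set ?_
  have h : Ioo (cellLeft m i) (cellRight m i) ∩ Ioo (0 : ℝ) 1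
      = Ioo (cellLeft m i) (cellRight m i) :=
    inter_eq_left.mpr (Ioo_subset_Ioo (cellLeft_nonneg hm i) (cellRight_le_one hm hs i))
  have h' := (Ioo_ae_eq_Ico (μ := (volume : Measure ℝ)) (a := cellLeft m i)
    (b := cellRight m i)).symm.inter (ae_eq_refl (Ioo (0 : ℝ) 1))
  rwa [h] at h'

/-- The mean of `U` over the `i`-th cell. -/
def cellMean (m : Fin N → ℝ) (U : ℝ → ℝ) (i : Fin N) : ℝ :=
  (m i)⁻¹ * ∫ y in Ioo (cellLeft m i) (cellRight m i), U y

theorem ae_cell_of_ae (hm : ∀ i, 0 < m i) (hs : ∑ i, m i = 1) (i : Fin N) {p : ℝ → Prop}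
    (h : ∀ᵐ y ∂μΩ, p y) : ∀ᵐ y ∂volume.restrict (Ioo (cellLeft m i) (cellRight m i)), p y := by
  rw [← restrict_cell hm hs i]
  exact ae_restrict_of_ae h

theorem cellMean_congr (hm : ∀ i, 0 < m i) (hs : ∑ i, m i = 1) {U W : ℝ → ℝ} (h : U =ᵐ[μΩ] W) :
    cellMean m U = cellMean m W := by
  ext i
  unfold cellMean
  rw [integral_congr_ae (ae_cell_of_ae hm hs i h)]

theorem cellMean_eq_of_ae (hm : ∀ i, 0 < m i) {U : ℝ → ℝ} {i : Fin N} {c : ℝ}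
    (h : ∀ᵐ y ∂volume.restrict (Ioo (cellLeft m i) (cellRight m i)), U y = c) :
    cellMean m U i = c := by
  unfold cellMean
  rw [integral_congr_ae h, setIntegral_const, measureReal_def, Real.volume_Ioo, cellRight_eq,
    add_sub_cancel_left, ENNReal.toReal_ofReal (hm i).le, smul_eq_mul,
    inv_mul_cancel_left₀ (hm i).ne']

theorem cellMean_step (hm : ∀ i, 0 < m i) (hs : ∑ i, m i = 1) (a : Fin N → ℝ) :
    cellMean m (step m a) = a := by
  rw [cellMean_congr hm hs (coeFn_step m a)]
  ext i
  refine cellMean_eq_of_ae hm ?_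
  filter_upwards [ae_restrict_mem measurableSet_Ioo] with y hy
  exact stepFun_eq hm a (Ioo_subset_Ico_self hy)

theorem integral_stepFun_mul (hm : ∀ i, 0 < m i) (hs : ∑ i, m i = 1) (a : Fin N → ℝ) {U : ℝ → ℝ}
    (hU : Integrable U μΩ) :
    ∫ y, stepFun m a y * U y ∂μΩ = ∑ i, m i * a i * cellMean m U i := by
  have h1 : (fun y => stepFun m a y * U y) = fun y => ∑ i,
      (Ico (cellLeft m i) (cellRight m i)).indicator (fun y => a i * U y) y := by
    ext y
    unfold stepFun
    rw [Finset.sum_mul]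
    refine Finset.sum_congr rfl fun i _ => ?_
    unfold cellLeft cellRight
    by_cases hy : y ∈ Ico (∑ j ∈ Finset.Iio i, m j) (∑ j ∈ Finset.Iic i, m j)
    · rw [indicator_of_mem hy, indicator_of_mem hy]
    · rw [indicator_of_notMem hy, indicator_of_notMem hy, zero_mul]
  rw [h1, integral_finsetSum _ fun i _ => (hU.const_mul (a i)).indicator measurableSet_Ico]
  refine Finset.sum_congr rfl fun i _ => ?_
  rw [integral_indicator measurableSet_Ico, restrict_cell hm hs, integral_const_mul, cellMean]
  have := (hm i).ne'
  field_simp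

theorem integrable_coeFn (U : L2Ω) : Integrable U μΩ :=
  have := isProbabilityMeasure_μΩ
  (Lp.memLp U).integrable (by norm_num)

/-- Averaging over cells is the adjoint of `step m` for the weighted inner product. This is what
turns every variational inequality in `L²(Ω)` into a finite sum. -/
theorem inner_step (hm : ∀ i, 0 < m i) (hs : ∑ i, m i = 1) (a : Fin N → ℝ) (U : L2Ω) :
    inner ℝ (step m a) U = ∑ i, m i * a i * cellMean m U i := by
  rw [L2.inner_def, ← integral_stepFun_mul hm hs a (integrable_coeFn U)]
  refine integral_congr_ae ?_
  filter_upwards [coeFn_step m a] with y hy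
  rw [hy, real_inner_eq_re_inner, RCLike.inner_apply]
  simp [mul_comm]

theorem inner_step_step (hm : ∀ i, 0 < m i) (hs : ∑ i, m i = 1) (a b : Fin N → ℝ) :
    inner ℝ (step m a) (step m b) = ∑ i, m i * a i * b i := by
  rw [inner_step hm hs, cellMean_step hm hs]

theorem integral_stepFun (hm : ∀ i, 0 < m i) (hs : ∑ i, m i = 1) (a : Fin N → ℝ) :
    ∫ y, stepFun m a y ∂μΩ = ∑ i, m i * a i := by
  have := isProbabilityMeasure_μΩ
  have h := integral_stepFun_mul hm hs a (integrable_const (1 : ℝ))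
  simp only [mul_one] at h
  rw [h]
  refine Finset.sum_congr rfl fun i _ => ?_
  rw [cellMean_eq_of_ae hm (c := 1) (by simp), mul_one]

theorem ae_mem_Ioo : ∀ᵐ y ∂μΩ, y ∈ Ioo (0 : ℝ) 1 := ae_restrict_mem measurableSet_Ioo

theorem integral_comp_step (hm : ∀ i, 0 < m i) (hs : ∑ i, m i = 1) (F : ℝ → ℝ) (a : Fin N → ℝ) :
    ∫ y, F (step m a y) ∂μΩ = ∑ i, m i * F (a i) := by
  rw [← integral_stepFun hm hs]
  refine integral_congr_ae ?_
  filter_upwards [coeFn_step m a, ae_mem_Ioo] with y hy hy'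
  rw [hy, stepFun_comp hm hs F a (Ioo_subset_Ico_self hy')]

/-- The discrete convolution `∑ j, m_j Φ(x_i - x_j)`. -/
def discreteConv (φ : ℝ → ℝ) (m x : Fin N → ℝ) (i : Fin N) : ℝ :=
  ∑ j, m j * primPhi φ (x i - x j)

theorem PhiConv_step {φ : ℝ → ℝ} (hφ : IsProtocol φ) (hm : ∀ i, 0 < m i) (hs : ∑ i, m i = 1)
    (x : Fin N → ℝ) : PhiConv hφ (step m x) = step m (discreteConv φ m x) := by
  unfold PhiConv
  conv_rhs => unfold step
  rw [MemLp.toLp_eq_toLp_iff]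
  filter_upwards [coeFn_step m x, ae_mem_Ioo] with y hy hy'
  rw [integral_comp_step hm hs (fun r => primPhi φ (step m x y - r)), hy,
    stepFun_comp hm hs (fun s => ∑ i, m i * primPhi φ (s - x i)) x (Ioo_subset_Ico_self hy')]
  rfl

/-- For `i < j` the value of the monotone representative at the right end of cell `i` separates the
two means. -/
theorem cellMean_monotone (hm : ∀ i, 0 < m i) (hs : ∑ i, m i = 1) {Z : L2Ω} (hZ : Z ∈ coneK) :
    Monotone (cellMean m Z) := by
  obtain ⟨f, hf, -, hZf⟩ := hZ
  have hfi : Integrable f μΩ := (integrable_coeFn Z).congr hZf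
  rw [cellMean_congr hm hs hZf]
  have hcell : ∀ i : Fin N, IntegrableOn f (Ioo (cellLeft m i) (cellRight m i)) volume := by
    intro i
    rw [IntegrableOn, ← restrict_cell hm hs i]
    exact hfi.restrict
  have hvol : ∀ i : Fin N, ∀ c : ℝ,
      ∫ _ in Ioo (cellLeft m i) (cellRight m i), c = m i * c := by
    intro i c
    rw [setIntegral_const, measureReal_def, Real.volume_Ioo, cellRight_eq,
      add_sub_cancel_left, ENNReal.toReal_ofReal (hm i).le, smul_eq_mul]
  intro i j hij
  rcases hij.eq_or_lt with rfl | hij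
  · exact le_rfl
  have hsep := cellRight_le_cellLeft hm hij
  have hi := cellLeft_lt_cellRight hm i
  have hj := cellLeft_lt_cellRight hm j
  have hi0 := cellLeft_nonneg hm i
  have hj1 := cellRight_le_one hm hs j
  set p := cellRight m i with hp
  have hpm : p ∈ Ioo (0 : ℝ) 1 := ⟨by linarith, by linarith⟩
  have hle : cellMean m f i ≤ f p := by
    unfold cellMean
    rw [inv_mul_le_iff₀ (hm i), ← hvol i]
    refine setIntegral_mono_on (hcell i) (integrableOn_const (by simp)) measurableSet_Ioo ?_
    intro y hy
    exact hf ⟨by linarith [hy.1], by linarith [hy.2, hpm.2]⟩ hpm hy.2.le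
  have hge : f p ≤ cellMean m f j := by
    unfold cellMean
    rw [le_inv_mul_iff₀ (hm j), ← hvol j]
    refine setIntegral_mono_on (integrableOn_const (by simp)) (hcell j) measurableSet_Ioo ?_
    intro y hy
    exact hf hpm ⟨by linarith [hy.1], by linarith [hy.2]⟩ (by linarith [hy.1])
  exact hle.trans hge

end Cells

/-! ### The set `Ω_X` and the space `ℋ_X` of a step function -/

section Omega

variable {N : ℕ} {m x : Fin N → ℝ}

/-- `a` takes equal values at particles with equal position. -/
def ConstOnClusters (x a : Fin N → ℝ) : Prop := ∀ i j, x i = x j → a i = a j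

theorem exists_ne_of_ae {p : ℝ → Prop} (h : ∀ᵐ y ∂(volume : Measure ℝ), p y) {a b : ℝ}
    (hab : a < b) : ∃ y ∈ Ioo a b, p y := by
  have h0 : volume (Ioo a b) ≠ 0 := by simp [Real.volume_Ioo, hab]
  obtain ⟨y, hy, hp⟩ := ((frequently_ae_mem_iff.mpr h0).and_eventually h).exists
  exact ⟨y, hy, hp⟩

/-- Near a point of `Ω_X` a nondecreasing step function is constant everywhere. -/
theorem stepFun_eventually_eq_of_mem_OmegaSet (hm : ∀ i, 0 < m i) (hs : ∑ i, m i = 1)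
    (hx : Monotone x) {y : ℝ} (hy : y ∈ OmegaSet (step m x)) :
    ∀ᶠ z in 𝓝 y, stepFun m x z = stepFun m x y := by
  obtain ⟨hy01, c, O, hO, hc⟩ := hy
  have hO' : O ∩ Ioo 0 1 ∈ 𝓝 y := inter_mem hO (Ioo_mem_nhds hy01.1 hy01.2)
  obtain ⟨ε, hε, hball⟩ := Metric.mem_nhds_iff.mp hO'
  rw [Real.ball_eq_Ioo] at hball
  have hae : ∀ᵐ z ∂(volume : Measure ℝ), z ∈ Ioo (y - ε) (y + ε) → stepFun m x z = c := by
    have h1 : ∀ᵐ z ∂μΩ, z ∈ O → stepFun m x z = c := by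
      filter_upwards [hc, coeFn_step m x] with z hz hz' hzO
      rw [← hz', hz hzO]
    rw [ae_restrict_iff' measurableSet_Ioo] at h1
    filter_upwards [h1] with z hz hzI
    exact hz (hball hzI).2 (hball hzI).1
  have hmono := (monotoneOn_stepFun hm hs hx).mono Ioo_subset_Ico_self
  -- Points where the value is `c` exist on both sides of `z`, and monotonicity squeezes the value
  -- at `z`.
  have hconst : ∀ z ∈ Ioo (y - ε) (y + ε), stepFun m x z = c := by
    intro z hz
    obtain ⟨u, hu, hu'⟩ := exists_ne_of_ae hae hz.1
    obtain ⟨w, hw, hw'⟩ := exists_ne_of_ae hae hz.2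
    have huI : u ∈ Ioo (y - ε) (y + ε) := ⟨hu.1, hu.2.trans hz.2⟩
    have hwI : w ∈ Ioo (y - ε) (y + ε) := ⟨hz.1.trans hw.1, hw.2⟩
    refine le_antisymm ?_ ?_
    · rw [← hw' hwI]
      exact hmono (hball hz).2 (hball hwI).2 hw.1.le
    · rw [← hu' huI]
      exact hmono (hball huI).2 (hball hz).2 hu.2.le
  filter_upwards [Ioo_mem_nhds (show y - ε < y by linarith) (show y < y + ε by linarith)] with z hz
  rw [hconst z hz, hconst y ⟨by linarith, by linarith⟩]

theorem ConstOnClusters.stepFun_eq (hm : ∀ i, 0 < m i) (hs : ∑ i, m i = 1) {a : Fin N → ℝ}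
    (ha : ConstOnClusters x a) {y z : ℝ} (hy : y ∈ Ioo (0 : ℝ) 1) (hz : z ∈ Ioo (0 : ℝ) 1)
    (h : stepFun m x z = stepFun m x y) : stepFun m a z = stepFun m a y := by
  obtain ⟨i, hi⟩ := exists_mem_cell hs (Ioo_subset_Ico_self hy)
  obtain ⟨j, hj⟩ := exists_mem_cell hs (Ioo_subset_Ico_self hz)
  rw [StickyParticles.stepFun_eq hm _ hi, StickyParticles.stepFun_eq hm _ hj] at h ⊢
  exact ha _ _ h

/-- With `a` a later configuration, this turns stickiness of the particles into the inclusion of the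
sets `Ω_X`. -/
theorem OmegaSet_step_subset (hm : ∀ i, 0 < m i) (hs : ∑ i, m i = 1) (hx : Monotone x)
    {a : Fin N → ℝ} (ha : ConstOnClusters x a) :
    OmegaSet (step m x) ⊆ OmegaSet (step m a) := by
  intro y hy
  refine ⟨hy.1, stepFun m a y, {z | stepFun m x z = stepFun m x y},
    stepFun_eventually_eq_of_mem_OmegaSet hm hs hx hy, ?_⟩
  filter_upwards [coeFn_step m a, ae_mem_Ioo] with z hz hz01 hzx
  rw [hz]
  exact ha.stepFun_eq hm hs hy.1 hz01 hzx

theorem step_mem_spaceH (hm : ∀ i, 0 < m i) (hs : ∑ i, m i = 1) (hx : Monotone x)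
    {a : Fin N → ℝ} (ha : ConstOnClusters x a) : step m a ∈ spaceH (step m x) := by
  intro p q hpq hsub
  have h01 : Ioo p q ⊆ Ioo 0 1 := fun y hy => (hsub hy).1
  set y := (p + q) / 2 with hy
  have hyI : y ∈ Ioo p q := ⟨by linarith, by linarith⟩
  -- Local constancy is a vanishing derivative, and a connected interval makes it global.
  have hconst : ∀ z ∈ Ioo p q, stepFun m x z = stepFun m x y := by
    intro z hz
    have hd : ∀ w ∈ Ioo p q, HasDerivAt (stepFun m x) 0 w := fun w hw =>
      (hasDerivAt_const w (stepFun m x w)).congr_of_eventuallyEq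
        (stepFun_eventually_eq_of_mem_OmegaSet hm hs hx (hsub hw))
    exact isOpen_Ioo.is_const_of_deriv_eq_zero isPreconnected_Ioo
      (fun w hw => (hd w hw).differentiableAt.differentiableWithinAt)
      (fun w hw => (hd w hw).deriv) hz hyI
  refine ⟨stepFun m a y, ?_⟩
  have h1 : ∀ᵐ z ∂volume.restrict (Ioo p q), step m a z = stepFun m a z :=
    ae_mono (Measure.restrict_mono h01 le_rfl) (coeFn_step m a)
  filter_upwards [h1, ae_restrict_mem measurableSet_Ioo] with z hz hz'
  rw [hz]
  exact ha.stepFun_eq hm hs (h01 hyI) (h01 hz') (hconst z hz')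

/-- If `x i = x j`, monotonicity makes all particles in between coincide too. The cells from `i` to
`j` then fill one interval inside `Ω_X`, on which `U` is constant. -/
theorem cellMean_constOnClusters (hm : ∀ i, 0 < m i) (hs : ∑ i, m i = 1) (hx : Monotone x)
    {U : L2Ω} (hU : U ∈ spaceH (step m x)) : ConstOnClusters x (cellMean m U) := by
  have key : ∀ i j, i < j → x i = x j → cellMean m U i = cellMean m U j := by
    intro i j hij hxij
    have hsep := cellRight_le_cellLeft hm hij
    have hi := cellLeft_lt_cellRight hm i
    have hj := cellLeft_lt_cellRight hm j
    have hi0 := cellLeft_nonneg hm i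
    have hj1 := cellRight_le_one hm hs j
    have hsub : Ioo (cellLeft m i) (cellRight m j) ⊆ OmegaSet (step m x) := by
      intro y hy
      refine ⟨⟨by linarith [hy.1], by linarith [hy.2]⟩, x i,
        Ioo (cellLeft m i) (cellRight m j), Ioo_mem_nhds hy.1 hy.2, ?_⟩
      filter_upwards [coeFn_step m x] with z hz hzI
      rw [hz]
      obtain ⟨k, hk⟩ := exists_mem_cell (y := z) hs ⟨by linarith [hzI.1], by linarith [hzI.2]⟩
      rw [StickyParticles.stepFun_eq hm x hk]
      have hik : i ≤ k := by
        by_contra h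
        linarith [cellRight_le_cellLeft hm (not_le.mp h), hk.2, hzI.1]
      have hkj : k ≤ j := by
        by_contra h
        linarith [cellRight_le_cellLeft hm (not_le.mp h), hk.1, hzI.2]
      exact le_antisymm (hxij ▸ hx hkj) (hx hik)
    obtain ⟨c, hc⟩ := hU _ _ (by linarith) hsub
    rw [cellMean_eq_of_ae hm (c := c), cellMean_eq_of_ae hm (c := c)]
    · exact ae_mono (Measure.restrict_mono (Ioo_subset_Ioo (by linarith) le_rfl) le_rfl) hc
    · exact ae_mono (Measure.restrict_mono (Ioo_subset_Ioo le_rfl (by linarith)) le_rfl) hc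
  intro i j hxij
  rcases lt_trichotomy i j with h | rfl | h
  · exact key i j h hxij
  · rfl
  · exact (key j i h hxij.symm).symm

end Omega

/-! ### Convexity of the potential -/

section Potential

variable {φ : ℝ → ℝ}

theorem monotone_primPhi (hφ : IsProtocol φ) : Monotone (primPhi φ) := by
  intro a b hab
  have hadd : primPhi φ a + ∫ y in a..b, φ y = primPhi φ b :=
    intervalIntegral.integral_add_adjacent_intervals
      (hφ.intervalIntegrable 0 a) (hφ.intervalIntegrable a b)
  have : 0 ≤ ∫ y in a..b, φ y := intervalIntegral.integral_nonneg hab fun y _ => hφ.nonneg y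
  linarith

theorem continuous_primW (hφ : IsProtocol φ) : Continuous (primW φ) :=
  intervalIntegral.continuous_primitive
    (fun a b => (continuous_primPhi hφ).intervalIntegrable a b) 0

/-- The tangent inequality for the convex function `W_Φ`. -/
theorem primW_add_le (hφ : IsProtocol φ) (a b : ℝ) :
    primW φ a + primPhi φ a * (b - a) ≤ primW φ b := by
  have hint := fun a b : ℝ => (continuous_primPhi hφ).intervalIntegrable (μ := volume) a b
  have hadd : primW φ a + ∫ y in a..b, primPhi φ y = primW φ b :=
    intervalIntegral.integral_add_adjacent_intervals (hint 0 a) (hint a b)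
  rcases le_total a b with h | h
  · have h1 : ∫ _ in a..b, primPhi φ a ≤ ∫ y in a..b, primPhi φ y :=
      intervalIntegral.integral_mono_on h intervalIntegrable_const (hint a b)
        fun y hy => monotone_primPhi hφ hy.1
    rw [intervalIntegral.integral_const, smul_eq_mul] at h1
    linarith
  · have h1 : ∫ y in b..a, primPhi φ y ≤ ∫ _ in b..a, primPhi φ a :=
      intervalIntegral.integral_mono_on h (hint b a) intervalIntegrable_const
        fun y hy => monotone_primPhi hφ hy.2
    rw [intervalIntegral.integral_const, smul_eq_mul] at h1
    rw [intervalIntegral.integral_symm] at hadd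
    linarith

theorem abs_primW_le (hφ : IsProtocol φ) (x : ℝ) :
    |primW φ x| ≤ (primPhi φ 1 + φ 1 * |x|) * |x| := by
  have h := intervalIntegral.norm_integral_le_of_norm_le_const (a := 0) (b := x)
    (f := primPhi φ) (C := primPhi φ 1 + φ 1 * |x|) (fun y hy => by
      have hy' : |y| ≤ |x| := by
        rcases le_total 0 x with h | h
        · rw [uIoc_of_le h] at hy
          rw [abs_of_nonneg h, abs_of_pos hy.1]; exact hy.2
        · rw [uIoc_of_ge h] at hy
          rw [abs_of_nonpos h, abs_of_nonpos hy.2]; linarith [hy.1]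
      refine (abs_primPhi_le hφ y).trans ?_
      gcongr
      exact hφ.nonneg 1)
  simpa [primW] using h

theorem memLp_sub_prod (X : L2Ω) :
    MemLp (fun p : ℝ × ℝ => X p.1 - X p.2) 2 (μΩ.prod μΩ) :=
  have := isProbabilityMeasure_μΩ
  ((Lp.memLp X).comp_fst μΩ).sub ((Lp.memLp X).comp_snd μΩ)

theorem integrable_primW_prod (hφ : IsProtocol φ) (X : L2Ω) :
    Integrable (fun p : ℝ × ℝ => primW φ (X p.1 - X p.2)) (μΩ.prod μΩ) := by
  have := isProbabilityMeasure_μΩ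
  have hd := memLp_sub_prod X
  have h1 : Integrable (fun p : ℝ × ℝ => primPhi φ 1 * |X p.1 - X p.2|
      + φ 1 * (X p.1 - X p.2) ^ 2) (μΩ.prod μΩ) :=
    ((hd.integrable (by norm_num)).abs.const_mul _).add (hd.integrable_sq.const_mul _)
  refine h1.mono' ((continuous_primW hφ).comp_aestronglyMeasurable hd.1)
    (Eventually.of_forall fun p => ?_)
  refine (abs_primW_le hφ _).trans_eq ?_
  rw [add_mul, mul_assoc, abs_mul_abs_self, sq]

theorem memLp_primPhi_prod (hφ : IsProtocol φ) (X : L2Ω) :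
    MemLp (fun p : ℝ × ℝ => primPhi φ (X p.1 - X p.2)) 2 (μΩ.prod μΩ) := by
  have := isProbabilityMeasure_μΩ
  have hd := memLp_sub_prod X
  have h1 : MemLp (fun p : ℝ × ℝ => primPhi φ 1 + φ 1 * |X p.1 - X p.2|) 2 (μΩ.prod μΩ) :=
    (memLp_const (primPhi φ 1)).add (hd.abs.const_mul (φ 1))
  have h2 : AEStronglyMeasurable (fun p : ℝ × ℝ => primPhi φ (X p.1 - X p.2)) (μΩ.prod μΩ) :=
    (continuous_primPhi hφ).comp_aestronglyMeasurable hd.1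
  refine h1.mono' h2 (Eventually.of_forall fun p => ?_)
  rw [Real.norm_eq_abs]
  exact abs_primPhi_le hφ (X p.1 - X p.2)

theorem inner_eq_integral_mul (X Y : L2Ω) : inner ℝ X Y = ∫ y, X y * Y y ∂μΩ := by
  rw [L2.inner_def]
  refine integral_congr_ae (Eventually.of_forall fun y => ?_)
  simp [mul_comm]

/-- `⟨Φ∗ρ(X), H⟩` as a symmetrized double integral. -/
theorem integral_primPhi_mul_sub (hφ : IsProtocol φ) (X H : L2Ω) :
    Integrable (fun p : ℝ × ℝ => primPhi φ (X p.1 - X p.2) * (H p.1 - H p.2)) (μΩ.prod μΩ) ∧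
    ∫ p, primPhi φ (X p.1 - X p.2) * (H p.1 - H p.2) ∂(μΩ.prod μΩ)
      = 2 * inner ℝ (PhiConv hφ X) H := by
  have := isProbabilityMeasure_μΩ
  have hΦ := memLp_primPhi_prod hφ X
  have hH := Lp.memLp H
  have h1 : Integrable (fun p : ℝ × ℝ => primPhi φ (X p.1 - X p.2) * H p.1) (μΩ.prod μΩ) :=
    hΦ.integrable_mul (hH.comp_fst μΩ)
  have h2 : Integrable (fun p : ℝ × ℝ => primPhi φ (X p.1 - X p.2) * H p.2) (μΩ.prod μΩ) :=
    hΦ.integrable_mul (hH.comp_snd μΩ)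
  have e1 : ∫ p, primPhi φ (X p.1 - X p.2) * H p.1 ∂(μΩ.prod μΩ) = inner ℝ (PhiConv hφ X) H := by
    rw [integral_prod _ h1, inner_eq_integral_mul]
    refine integral_congr_ae ?_
    filter_upwards [(memLp_conv hφ X).coeFn_toLp] with y hy
    rw [integral_mul_const]
    unfold PhiConv
    rw [hy]
  -- Exchanging the two variables flips the sign because `Φ` is odd. This produces the factor `2`,
  -- which the `½` in the potential cancels.
  have e2 : ∫ p, primPhi φ (X p.1 - X p.2) * H p.2 ∂(μΩ.prod μΩ)
      = -inner ℝ (PhiConv hφ X) H := by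
    rw [← e1, ← integral_prod_swap, ← integral_neg]
    refine integral_congr_ae (Eventually.of_forall fun p => ?_)
    simp only [Prod.fst_swap, Prod.snd_swap]
    rw [← neg_sub, primPhi_neg hφ, neg_mul]
  simp only [mul_sub]
  refine ⟨h1.sub h2, ?_⟩
  rw [integral_sub h1 h2, e1, e2]
  ring

/-- The potential is convex with gradient `Φ∗ρ(X) - Ψ̄`. -/
theorem potential_add_inner_le (hφ : IsProtocol φ) (Ψbar X Z : L2Ω) :
    potential φ Ψbar X + inner ℝ (PhiConv hφ X - Ψbar) (Z - X) ≤ potential φ Ψbar Z := by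
  have := isProbabilityMeasure_μΩ
  have hX := integrable_primW_prod hφ X
  have hZ := integrable_primW_prod hφ Z
  obtain ⟨hi, he⟩ := integral_primPhi_mul_sub hφ X (Z - X)
  have hsub : ∀ᵐ y ∂μΩ, (Z - X : L2Ω) y = Z y - X y := Lp.coeFn_sub Z X
  have hfst : ∀ᵐ p ∂(μΩ.prod μΩ), (Z - X : L2Ω) p.1 = Z p.1 - X p.1 :=
    Measure.quasiMeasurePreserving_fst.ae hsub
  have hsnd : ∀ᵐ p ∂(μΩ.prod μΩ), (Z - X : L2Ω) p.2 = Z p.2 - X p.2 :=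
    Measure.quasiMeasurePreserving_snd.ae hsub
  have hle : ∫ p, (primW φ (X p.1 - X p.2)
      + primPhi φ (X p.1 - X p.2) * ((Z - X : L2Ω) p.1 - (Z - X : L2Ω) p.2)) ∂(μΩ.prod μΩ)
      ≤ ∫ p, primW φ (Z p.1 - Z p.2) ∂(μΩ.prod μΩ) := by
    refine integral_mono_ae (hX.add hi) hZ ?_
    filter_upwards [hfst, hsnd] with p h1 h2
    rw [h1, h2]
    refine le_trans (le_of_eq ?_) (primW_add_le hφ (X p.1 - X p.2) (Z p.1 - Z p.2))
    ring
  rw [integral_add hX hi, he, integral_prod _ hX, integral_prod _ hZ] at hle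
  unfold potential
  rw [inner_sub_left, inner_sub_right Ψbar]
  linarith

end Potential

/-! ### Subdifferential of the indicator function and metric projections -/

theorem mem_subdiff_indK {X Y : L2Ω} (hX : X ∈ coneK) :
    Y ∈ subdiff indK X ↔ ∀ Z ∈ coneK, inner ℝ Y (Z - X) ≤ (0 : ℝ) := by
  constructor
  · intro h Z hZ
    have := h Z
    rw [indK, indK, if_pos hX, if_pos hZ, zero_add] at this
    exact_mod_cast this
  · intro h Z
    by_cases hZ : Z ∈ coneK
    · rw [indK, indK, if_pos hX, if_pos hZ, zero_add]
      exact_mod_cast h Z hZ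
    · rw [indK, indK, if_neg hZ]
      exact le_top

theorem mem_subdiff_potentialK {φ : ℝ → ℝ} {Ψbar X Y : L2Ω} (hX : X ∈ coneK) :
    Y ∈ subdiff (potentialK φ Ψbar) X ↔
      ∀ Z ∈ coneK, potential φ Ψbar X + inner ℝ Y (Z - X) ≤ potential φ Ψbar Z := by
  constructor
  · intro h Z hZ
    have := h Z
    rw [potentialK, potentialK, indK, indK, if_pos hX, if_pos hZ, add_zero, add_zero] at this
    exact_mod_cast this
  · intro h Z
    by_cases hZ : Z ∈ coneK
    · rw [potentialK, potentialK, indK, indK, if_pos hX, if_pos hZ, add_zero, add_zero]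
      exact_mod_cast h Z hZ
    · rw [potentialK, potentialK, indK, indK, if_neg hZ, EReal.coe_add_top]
      exact le_top

theorem isMetricProj_of_inner_le {C : Set L2Ω} {Z Y : L2Ω} (hY : Y ∈ C)
    (h : ∀ W ∈ C, inner ℝ (Z - Y) (W - Y) ≤ (0 : ℝ)) : IsMetricProj C Z Y := by
  refine ⟨hY, fun W hW => ?_⟩
  have h1 : ‖Z - W‖ ^ 2 = ‖Z - Y‖ ^ 2 - 2 * inner ℝ (Z - Y) (W - Y) + ‖W - Y‖ ^ 2 := by
    rw [← norm_sub_sq_real, sub_sub_sub_cancel_right]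
  refine (sq_le_sq₀ (norm_nonneg _) (norm_nonneg _)).mp ?_
  nlinarith [h W hW, sq_nonneg ‖W - Y‖]

theorem isMetricProj_coneK_of_mem_subdiff {X Z : L2Ω} (hX : X ∈ coneK)
    (h : Z - X ∈ subdiff indK X) : IsMetricProj coneK Z X :=
  isMetricProj_of_inner_le hX ((mem_subdiff_indK hX).mp h)

/-! ### The tangent cone of the monotone vectors -/

section Cone

variable {N : ℕ} {m x : Fin N → ℝ}

/-- The directions that preserve the order of coinciding particles. -/
def feasibleCone (x : Fin N → ℝ) : Set (Fin N → ℝ) :=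
  {w | ∀ i j, i ≤ j → x i = x j → w i ≤ w j}

/-- Coinciding pairs are kept in order by `w`, and strictly separated pairs by continuity for small
`ε`. There are finitely many pairs. -/
theorem eventually_monotone_add_smul (hx : Monotone x) {w : Fin N → ℝ} (hw : w ∈ feasibleCone x) :
    ∀ᶠ ε in 𝓝[>] (0 : ℝ), Monotone (x + ε • w) := by
  have h : ∀ i j : Fin N, ∀ᶠ ε in 𝓝[>] (0 : ℝ), i ≤ j → (x + ε • w) i ≤ (x + ε • w) j := by
    intro i j
    by_cases hij : i ≤ j
    · rcases (hx hij).eq_or_lt with he | hlt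
      · filter_upwards [self_mem_nhdsWithin] with ε hε _
        simp only [Pi.add_apply, Pi.smul_apply, smul_eq_mul, he]
        have := mul_le_mul_of_nonneg_left (hw i j hij he) (le_of_lt (mem_Ioi.mp hε))
        linarith
      · have hc : ∀ k, Tendsto (fun ε : ℝ => (x + ε • w) k) (𝓝[>] 0) (𝓝 (x k)) := fun k => by
          have : Continuous fun ε : ℝ => x k + ε * w k := by fun_prop
          have h0 := this.tendsto 0
          simp only [zero_mul, add_zero] at h0
          exact h0.mono_left nhdsWithin_le_nhds
        filter_upwards [(hc i).eventually_lt (hc j) hlt] with ε hε _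
        exact hε.le
    · exact Eventually.of_forall fun _ h => absurd h hij
  filter_upwards [eventually_all.mpr fun i => eventually_all.mpr fun j => h i j] with ε hε i j hij
  exact hε i j hij

theorem feasibleCone_subset_tangentCone (hx : Monotone x) :
    feasibleCone x ⊆ tangentCone x := by
  intro w hw
  refine subset_closure ?_
  obtain ⟨ε, hmono, hε⟩ :=
    ((eventually_monotone_add_smul hx hw).and self_mem_nhdsWithin).exists
  have hε' : 0 < ε := hε
  refine ⟨ε⁻¹, by positivity, x + ε • w, hmono, ?_⟩
  rw [add_sub_cancel_left, inv_smul_smul₀ hε'.ne']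

theorem tangentCone_subset_feasibleCone : tangentCone x ⊆ feasibleCone x := by
  refine closure_minimal ?_ ?_
  · rintro w ⟨ϑ, hϑ, y, hy, rfl⟩ i j hij he
    simp only [Pi.smul_apply, Pi.sub_apply, smul_eq_mul, he]
    exact mul_le_mul_of_nonneg_left (by linarith [hy hij]) hϑ
  · have : feasibleCone x = ⋂ i, ⋂ j, ⋂ (_ : i ≤ j), ⋂ (_ : x i = x j), {w | w i ≤ w j} := by
      ext w; simp [feasibleCone]
    rw [this]
    refine isClosed_iInter fun i => isClosed_iInter fun j => isClosed_iInter fun _ =>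
      isClosed_iInter fun _ => isClosed_le (continuous_apply i) (continuous_apply j)

theorem nonpos_of_forall_two_mul_le {A B : ℝ} (h : ∀ ε : ℝ, 0 < ε → ε ≤ 1 → 2 * A ≤ ε * B) :
    A ≤ 0 := by
  by_contra hA
  push Not at hA
  have hB : 0 < |B| + 1 := by positivity
  -- This choice gives `ε * B ≤ A`, which contradicts `2 * A ≤ ε * B` when `A > 0`.
  set ε := min 1 (A / (|B| + 1)) with hε
  have h0 : 0 < ε := lt_min one_pos (by positivity)
  have h1 := h ε h0 (min_le_left _ _)
  have h2 : ε * (|B| + 1) ≤ A := (le_div_iff₀ hB).mp (min_le_right _ _)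
  nlinarith [mul_le_mul_of_nonneg_left (le_abs_self B) h0.le]

/-- The variational inequality for the weighted projection on the tangent cone. -/
theorem IsWeightedProj.sum_nonpos {u v : Fin N → ℝ} (hx : Monotone x)
    (h : IsWeightedProj m (tangentCone x) u v) {w : Fin N → ℝ}
    (hw : ∀ ε : ℝ, 0 < ε → ε ≤ 1 → v + ε • w ∈ feasibleCone x) :
    ∑ i, m i * (u i - v i) * w i ≤ 0 := by
  refine nonpos_of_forall_two_mul_le (B := ∑ i, m i * w i ^ 2) fun ε h0 h1 => ?_
  have h2 := h.2 _ (feasibleCone_subset_tangentCone hx (hw ε h0 h1))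
  have h3 : ∑ i, m i * (u i - (v + ε • w) i) ^ 2 = ∑ i, m i * (u i - v i) ^ 2
      - 2 * ε * (∑ i, m i * (u i - v i) * w i) + ε ^ 2 * ∑ i, m i * w i ^ 2 := by
    rw [Finset.mul_sum, Finset.mul_sum, ← Finset.sum_sub_distrib, ← Finset.sum_add_distrib]
    refine Finset.sum_congr rfl fun i _ => ?_
    simp only [Pi.add_apply, Pi.smul_apply, smul_eq_mul]
    ring
  rw [h3] at h2
  have h4 : ε * (2 * (∑ i, m i * (u i - v i) * w i)) ≤ ε * (ε * ∑ i, m i * w i ^ 2) := by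
    nlinarith
  exact le_of_mul_le_mul_left h4 h0

theorem IsWeightedProj.sum_nonpos_of_mem {u v : Fin N → ℝ} (hx : Monotone x)
    (h : IsWeightedProj m (tangentCone x) u v) {w : Fin N → ℝ} (hw : w ∈ feasibleCone x) :
    ∑ i, m i * (u i - v i) * w i ≤ 0 := by
  have hv := tangentCone_subset_feasibleCone h.1
  refine h.sum_nonpos hx fun ε h0 _ i j hij he => ?_
  simp only [Pi.add_apply, Pi.smul_apply, smul_eq_mul]
  have h1 := hv i j hij he
  have h2 := mul_le_mul_of_nonneg_left (hw i j hij he) h0.le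
  linarith

/-- The projection of a vector which is nonincreasing on each cluster is constant there. -/
theorem IsWeightedProj.constOnClusters (hm : ∀ i, 0 < m i) {u v : Fin N → ℝ} (hx : Monotone x)
    (h : IsWeightedProj m (tangentCone x) u v)
    (hu : ∀ i j, i ≤ j → x i = x j → u j ≤ u i) : ConstOnClusters x v := by
  intro i₀ j₀ he₀
  have hv := tangentCone_subset_feasibleCone h.1
  -- The weighted residual on one cluster is tested against perturbations supported on that cluster.
  -- The perturbations `±1` and `±v` show that it is orthogonal to both `1` and `v`.
  let n : Fin N → ℝ := fun i => m i * (u i - v i)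
  let C : Finset (Fin N) := Finset.univ.filter fun k => x k = x i₀
  have hC : ∀ k, k ∈ C ↔ x k = x i₀ := fun k => by simp [C]
  have hscale : ∀ s : Fin N → ℝ, (∀ i j, i ≤ j → x i = x j → ∀ ε : ℝ, 0 < ε → ε ≤ 1 →
      v i + ε * (if i ∈ C then s i else 0) ≤ v j + ε * (if j ∈ C then s j else 0)) →
      ∑ i ∈ C, n i * s i ≤ 0 := by
    intro s hs
    have := h.sum_nonpos hx (w := fun i => if i ∈ C then s i else 0)
      fun ε h0 h1 i j hij he => hs i j hij he ε h0 h1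
    simpa [n, Finset.sum_ite_mem, mul_ite] using this
  have hcc : ∀ i j, x i = x j → (i ∈ C ↔ j ∈ C) := fun i j he => by rw [hC, hC, he]
  have e1 : ∑ i ∈ C, n i = 0 := by
    refine le_antisymm ?_ ?_
    · have := hscale (fun _ => 1) fun i j hij he ε h0 h1 => by
        simp only [hcc i j he]
        linarith [hv i j hij he]
      simpa using this
    · have := hscale (fun _ => -1) fun i j hij he ε h0 h1 => by
        simp only [hcc i j he]
        linarith [hv i j hij he]
      simpa using this
  have e2 : ∑ i ∈ C, n i * v i = 0 := by
    refine le_antisymm ?_ ?_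
    · refine hscale v fun i j hij he ε h0 h1 => ?_
      simp only [hcc i j he]
      have := hv i j hij he
      split_ifs
      · nlinarith
      · linarith
    -- Here `ε ≤ 1` is needed: the perturbed vector is `(1 - ε) v` on the cluster and must stay
    -- nondecreasing there.
    · have := hscale (fun i => -v i) fun i j hij he ε h0 h1 => by
        simp only [hcc i j he]
        have := hv i j hij he
        split_ifs
        · nlinarith
        · linarith
      simpa using this
  -- A Chebyshev-type argument. As `u` is nonincreasing and `v` nondecreasing on the cluster, each
  -- symmetrized term is at most `-m_k m_l (v_k - v_l)²`. The double sum vanishes by the two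
  -- orthogonality relations, so every square is zero.
  have hterm : ∀ k ∈ C, ∀ l ∈ C,
      (m l * n k - m k * n l) * (v k - v l) ≤ -(m k * m l * (v k - v l) ^ 2) := by
    have aux : ∀ k l, k ≤ l → x k = x l →
        (m l * n k - m k * n l) * (v k - v l) ≤ -(m k * m l * (v k - v l) ^ 2) := by
      intro k l hkl he
      have h1 := hv k l hkl he
      have h2 := hu k l hkl he
      have h3 : 0 ≤ m k * m l := mul_nonneg (hm k).le (hm l).le
      have h4 : (m l * n k - m k * n l) * (v k - v l) = -(m k * m l * (v k - v l) ^ 2)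
          - m k * m l * ((u k - u l) * (v l - v k)) := by
        simp only [n]; ring
      rw [h4]
      have := mul_nonneg h3 (mul_nonneg (sub_nonneg.mpr h2) (sub_nonneg.mpr h1))
      linarith
    intro k hk l hl
    have he : x k = x l := ((hC k).mp hk).trans ((hC l).mp hl).symm
    rcases le_total k l with hkl | hkl
    · exact aux k l hkl he
    · have := aux l k hkl he.symm
      nlinarith
  have hzero : ∑ k ∈ C, ∑ l ∈ C, (m l * n k - m k * n l) * (v k - v l) = 0 := by
    have h1 : ∑ k ∈ C, ∑ l ∈ C, (m l * n k - m k * n l) * (v k - v l)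
        = 2 * ((∑ k ∈ C, n k * v k) * ∑ l ∈ C, m l)
          - 2 * ((∑ k ∈ C, n k) * ∑ l ∈ C, m l * v l) := by
      have h2 : ∑ k ∈ C, ∑ l ∈ C, (m k * n l * v l) = (∑ k ∈ C, n k * v k) * ∑ l ∈ C, m l := by
        rw [mul_comm, Finset.sum_mul_sum]
        exact Finset.sum_congr rfl fun k _ => Finset.sum_congr rfl fun l _ => by ring
      have h3 : ∑ k ∈ C, ∑ l ∈ C, (n l * (m k * v k)) = (∑ k ∈ C, n k) * ∑ l ∈ C, m l * v l := by
        rw [mul_comm, Finset.sum_mul_sum]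
        exact Finset.sum_congr rfl fun k _ => Finset.sum_congr rfl fun l _ => by ring
      have h4 := h2
      have h5 := h3
      rw [Finset.sum_comm] at h4 h5
      calc _ = ∑ k ∈ C, ∑ l ∈ C, (m l * n k * v k + m k * n l * v l
              - n k * (m l * v l) - n l * (m k * v k)) :=
            Finset.sum_congr rfl fun k _ => Finset.sum_congr rfl fun l _ => by ring
        _ = _ := by
            simp only [Finset.sum_add_distrib, Finset.sum_sub_distrib]
            rw [h4, h2, h5, h3]
            ring
    rw [h1, e1, e2]
    ring
  have hsq : ∑ k ∈ C, ∑ l ∈ C, m k * m l * (v k - v l) ^ 2 ≤ 0 := by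
    have : ∑ k ∈ C, ∑ l ∈ C, (m l * n k - m k * n l) * (v k - v l)
        ≤ ∑ k ∈ C, ∑ l ∈ C, -(m k * m l * (v k - v l) ^ 2) :=
      Finset.sum_le_sum fun k hk => Finset.sum_le_sum fun l hl => hterm k hk l hl
    rw [hzero] at this
    simp only [Finset.sum_neg_distrib] at this
    linarith
  have hnn : ∀ k l, 0 ≤ m k * m l * (v k - v l) ^ 2 := fun k l =>
    mul_nonneg (mul_nonneg (hm k).le (hm l).le) (sq_nonneg _)
  have hone : m i₀ * m j₀ * (v i₀ - v j₀) ^ 2 ≤ 0 := by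
    refine le_trans ?_ hsq
    refine le_trans ?_ (Finset.single_le_sum (f := fun k => ∑ l ∈ C, m k * m l * (v k - v l) ^ 2)
      (fun k _ => Finset.sum_nonneg fun l _ => hnn k l) ((hC i₀).mpr rfl))
    exact Finset.single_le_sum (f := fun l => m i₀ * m l * (v i₀ - v l) ^ 2)
      (fun l _ => hnn i₀ l) ((hC j₀).mpr he₀.symm)
  have hpos := mul_pos (hm i₀) (hm j₀)
  have : (v i₀ - v j₀) ^ 2 = 0 := le_antisymm (by nlinarith) (sq_nonneg _)
  exact sub_eq_zero.mp (pow_eq_zero_iff two_ne_zero |>.mp this)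

end Cone

/-! ### The particle dynamics -/

section Dynamics

variable {φ : ℝ → ℝ} {N : ℕ} {m xbar vbar : Fin N → ℝ} {x v : ℝ → Fin N → ℝ}

theorem psi_eq (φ : ℝ → ℝ) (m x v : Fin N → ℝ) : psi φ m x v = v + discreteConv φ m x := rfl

theorem continuous_discreteConv (hφ : IsProtocol φ) (m : Fin N → ℝ) :
    Continuous (discreteConv φ m) := by
  have := continuous_primPhi hφ
  unfold discreteConv
  fun_prop

theorem constOnClusters_discreteConv (φ : ℝ → ℝ) (m x : Fin N → ℝ) :
    ConstOnClusters x (discreteConv φ m x) := fun i j h => by simp only [discreteConv, h]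

namespace IsStickyParticleSolution

theorem exists_isolating (h : IsStickyParticleSolution φ m xbar vbar x v) (t : ℝ) :
    ∃ δ > 0, ∀ r ∈ Ioo (t - δ) (t + δ), IsCollisionTime x r → r = t := by
  have hf : ({r | IsCollisionTime x r} \ {t}).Finite := h.finite_coll.subset sdiff_subset
  have hn : ({r | IsCollisionTime x r} \ {t})ᶜ ∈ 𝓝 t :=
    hf.isClosed.isOpen_compl.mem_nhds (by simp)
  obtain ⟨δ, hδ, hb⟩ := Metric.mem_nhds_iff.mp hn
  rw [Real.ball_eq_Ioo] at hb
  exact ⟨δ, hδ, fun r hr hc => by_contra fun hne => hb hr ⟨hc, hne⟩⟩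

theorem psi_congr (h : IsStickyParticleSolution φ m xbar vbar x v) {a b : ℝ} (ha : 0 ≤ a)
    (hab : a ≤ b) (hc : ∀ t ∈ Ioc a b, ¬ IsCollisionTime x t) :
    psi φ m (x b) (v b) = psi φ m (x a) (v a) := funext (h.free a b ha hab hc)

theorem hasDerivWithinAt_apply (h : IsStickyParticleSolution φ m xbar vbar x v) {t : ℝ}
    (ht : 0 ≤ t) (i : Fin N) : HasDerivWithinAt (fun s => x s i) (v t i) (Ici t) t :=
  hasDerivWithinAt_pi.mp (h.deriv_right t ht) i

theorem continuousOn_apply (h : IsStickyParticleSolution φ m xbar vbar x v) (i : Fin N) :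
    ContinuousOn (fun s => x s i) (Ici 0) := continuousOn_pi.mp h.cont i

/-- Particles that meet at `c` have nonincreasing velocities just before `c`. -/
theorem left_velocity_antitone (h : IsStickyParticleSolution φ m xbar vbar x v) {c : ℝ}
    (hc : 0 < c) {vm : Fin N → ℝ} (hvm : Tendsto v (𝓝[<] c) (𝓝 vm)) {i j : Fin N} (hij : i ≤ j)
    (he : x c i = x c j) : vm j ≤ vm i := by
  by_contra hlt
  push Not at hlt
  have hlim : Tendsto (fun s => v s j - v s i) (𝓝[<] c) (𝓝 (vm j - vm i)) :=
    ((tendsto_pi_nhds.mp hvm j).sub (tendsto_pi_nhds.mp hvm i))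
  set δ := (vm j - vm i) / 2 with hδ
  have hδ0 : 0 < δ := by rw [hδ]; linarith
  have hev := hlim.eventually_const_lt (show δ < vm j - vm i by linarith)
  obtain ⟨a, ha, hsub⟩ := (mem_nhdsLT_iff_exists_Ioo_subset' hc).mp
    (hev.and (eventually_nhdsWithin_of_eventually_nhds (lt_mem_nhds hc)))
  have hac : a < c := ha
  set b := (a + c) / 2 with hb
  have hbI : b ∈ Ioo a c := ⟨by linarith, by linarith⟩
  have hb0 : 0 < b := (hsub hbI).2
  -- If the limits were increasing, `x_i - x_j` would decrease at rate at least `δ` on `[b, c)`. It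
  -- is nonpositive at `b`, so it would be negative at `c`, where it is zero.
  have hmain := image_le_of_deriv_right_le_deriv_boundary (a := b) (b := c)
    (f := fun s => x s i - x s j) (f' := fun s => v s i - v s j)
    (B := fun s => x b i - x b j - δ * (s - b)) (B' := fun _ => -δ)
    (((h.continuousOn_apply i).sub (h.continuousOn_apply j)).mono
      fun s hs => hb0.le.trans hs.1)
    (fun s hs => (h.hasDerivWithinAt_apply (hb0.le.trans hs.1) i).sub
      (h.hasDerivWithinAt_apply (hb0.le.trans hs.1) j))
    (by simp)
    (by fun_prop)
    (fun s _ => by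
      have : HasDerivAt (fun s => x b i - x b j - δ * (s - b)) (-δ) s := by
        simpa using (((hasDerivAt_id s).sub_const b).const_mul δ).const_sub (x b i - x b j)
      exact this.hasDerivWithinAt)
    (fun s hs => by
      have := (hsub ⟨hbI.1.trans_le hs.1, hs.2⟩).1
      linarith)
  have h1 := hmain (right_mem_Icc.mpr hbI.2.le)
  simp only [he, sub_self] at h1
  have h2 := h.ordered b hb0.le hij
  have h3 : 0 < δ * (c - b) := mul_pos hδ0 (by linarith [hbI.2])
  linarith

theorem velocity_eq_of_eventually_eq (h : IsStickyParticleSolution φ m xbar vbar x v) {t : ℝ}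
    (ht : 0 ≤ t) {i j : Fin N} (he : ∀ᶠ s in 𝓝[≥] t, x s i = x s j) : v t i = v t j := by
  have h1 : HasDerivWithinAt (fun s => x s i) (v t j) (Ici t) t :=
    (h.hasDerivWithinAt_apply ht j).congr_of_eventuallyEq he (he.self_of_nhdsWithin self_mem_Ici)
  exact (uniqueDiffWithinAt_Ici t).eq_deriv _ (h.hasDerivWithinAt_apply ht i) h1

/-- Particles at the same place have the same velocity. -/
theorem velocity_constOnClusters (h : IsStickyParticleSolution φ m xbar vbar x v)
    (hm : ∀ i, 0 < m i) (hxbar : StrictMono xbar) {c : ℝ} (hc : 0 ≤ c) :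
    ConstOnClusters (x c) (v c) := by
  rcases hc.eq_or_lt with rfl | hc0
  · intro i j hij
    rw [h.init_pos] at hij
    rw [hxbar.injective hij]
  by_cases hcoll : IsCollisionTime x c
  · obtain ⟨vm, hvm, hproj⟩ := h.collision c hcoll
    exact hproj.constOnClusters hm (h.ordered c hc)
      fun i j hij he => h.left_velocity_antitone hc0 hvm hij he
  -- Without a collision at `c` the two particles already coincided just before. Their velocities
  -- agree at such an earlier `r`, and constancy of `ψ` on `[r, c]` carries this to `c`.
  · intro i j hij
    have hev : ∀ᶠ s in 𝓝[<] c, x s i = x s j := by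
      by_contra hne
      exact hcoll ⟨hc0, i, j, hij, fun hf => hne (hf.mono fun s hs => not_not.mp hs)⟩
    obtain ⟨δ, hδ, hiso⟩ := h.exists_isolating c
    obtain ⟨a, ha, hsub⟩ := (mem_nhdsLT_iff_exists_Ioo_subset' hc0).mp hev
    have hac : a < c := ha
    obtain ⟨r, hr, hrc⟩ : ∃ r, max (max a (c - δ)) 0 < r ∧ r < c :=
      exists_between (max_lt (max_lt hac (by linarith)) hc0)
    simp only [max_lt_iff] at hr
    have hpsi := h.psi_congr hr.2.le hrc.le fun t ht hct => by
      have := hiso t ⟨by linarith [ht.1, hr.1.2], by linarith [ht.2]⟩ hct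
      exact hcoll (this ▸ hct)
    have hvr : v r i = v r j := h.velocity_eq_of_eventually_eq hr.2.le <| by
      filter_upwards [Ico_mem_nhdsGE hrc] with s hs
      exact hsub ⟨hr.1.1.trans_le hs.1, hs.2⟩
    have hxr : x r i = x r j := hsub ⟨hr.1.1, hrc⟩
    have hi := congrFun hpsi i
    have hj := congrFun hpsi j
    simp only [psi_eq, Pi.add_apply] at hi hj
    rw [constOnClusters_discreteConv φ m (x c) i j hij,
      constOnClusters_discreteConv φ m (x r) i j hxr, hvr, ← hj] at hi
    linarith

/-- At `c` both velocities and forces agree, so `ψ_i = ψ_j` until the next collision. There `v_j -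
v_i` equals minus the difference of the convolutions, which is nonpositive because `Φ` is
nondecreasing. The nonnegative gap starts at zero and cannot grow. No uniqueness for the
differential equation is used, so a singular `φ` is harmless. -/
theorem exists_Icc_eq (h : IsStickyParticleSolution φ m xbar vbar x v) (hφ : IsProtocol φ)
    (hm : ∀ i, 0 < m i) (hxbar : StrictMono xbar) {c : ℝ} (hc : 0 ≤ c) {i j : Fin N}
    (hij : i ≤ j) (he : x c i = x c j) : ∃ b > c, ∀ s ∈ Icc c b, x s i = x s j := by
  obtain ⟨δ, hδ, hiso⟩ := h.exists_isolating c
  refine ⟨c + δ / 2, by linarith, ?_⟩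
  have hv := h.velocity_constOnClusters hm hxbar hc i j he
  have hbound : ∀ s ∈ Ico c (c + δ / 2), v s j - v s i ≤ 0 := by
    intro s hs
    have hpsi := h.psi_congr hc hs.1 fun t ht hct => by
      have := hiso t ⟨by linarith [ht.1], by linarith [ht.2, hs.2]⟩ hct
      linarith [ht.1]
    have hi := congrFun hpsi i
    have hj := congrFun hpsi j
    simp only [psi_eq, Pi.add_apply] at hi hj
    rw [constOnClusters_discreteConv φ m (x c) i j he, hv] at hi
    have hconv : discreteConv φ m (x s) i ≤ discreteConv φ m (x s) j :=
      Finset.sum_le_sum fun k _ => mul_le_mul_of_nonneg_left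
        (monotone_primPhi hφ (by linarith [h.ordered s (hc.trans hs.1) hij])) (hm k).le
    linarith
  have hmain := image_le_of_deriv_right_le_deriv_boundary (a := c) (b := c + δ / 2)
    (f := fun s => x s j - x s i) (f' := fun s => v s j - v s i)
    (B := fun _ => 0) (B' := fun _ => 0)
    (((h.continuousOn_apply j).sub (h.continuousOn_apply i)).mono fun s hs => hc.trans hs.1)
    (fun s hs => (h.hasDerivWithinAt_apply (hc.trans hs.1) j).sub
      (h.hasDerivWithinAt_apply (hc.trans hs.1) i))
    (by simp [he]) continuousOn_const (fun s _ => hasDerivWithinAt_const _ _ _) hbound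
  intro s hs
  have h1 := hmain hs
  exact le_antisymm (h.ordered s (hc.trans hs.1) hij) (by linarith)

/-- Particles that have met stay together. -/
theorem sticky (h : IsStickyParticleSolution φ m xbar vbar x v) (hφ : IsProtocol φ)
    (hm : ∀ i, 0 < m i) (hxbar : StrictMono xbar) {s t : ℝ} (hs : 0 ≤ s) (hst : s ≤ t) :
    ConstOnClusters (x s) (x t) := by
  have key : ∀ i j, i ≤ j → x s i = x s j → x t i = x t j := by
    intro i j hij he
    -- Continuous induction: the coincidence set is closed and extends to the right of each of its
    -- points.
    have hsub : Icc s t ⊆ {r | x r i = x r j} := by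
      refine IsClosed.Icc_subset_of_forall_exists_gt ?_ he ?_
      · have hcl : IsClosed (Icc s t ∩ (fun r => x r i - x r j) ⁻¹' {0}) :=
          ((((h.continuousOn_apply i).sub (h.continuousOn_apply j)).mono
            fun r hr => hs.trans hr.1)).preimage_isClosed_of_isClosed isClosed_Icc
            isClosed_singleton
        convert hcl using 1
        ext r
        simp [sub_eq_zero, and_comm]
      · rintro r ⟨hr, hrI⟩ y hy
        obtain ⟨b, hb, hbe⟩ := h.exists_Icc_eq hφ hm hxbar (hs.trans hrI.1) hij hr
        exact ⟨min b y, hbe _ ⟨(lt_min hb hy).le, min_le_left _ _⟩, lt_min hb hy,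
          min_le_right _ _⟩
    exact hsub (right_mem_Icc.mpr hst)
  intro i j he
  rcases le_total i j with hij | hij
  · exact key i j hij he
  · exact (key j i hij he.symm).symm

/-- Clusters only grow, so the constraints accumulate. Hence a direction admissible at the final
time may be tested at every earlier collision. -/
theorem feasibleCone_anti (h : IsStickyParticleSolution φ m xbar vbar x v) (hφ : IsProtocol φ)
    (hm : ∀ i, 0 < m i) (hxbar : StrictMono xbar) {s t : ℝ} (hs : 0 ≤ s) (hst : s ≤ t) :
    feasibleCone (x t) ⊆ feasibleCone (x s) :=
  fun _ hw i j hij he => hw i j hij (h.sticky hφ hm hxbar hs hst i j he)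

/-- At a collision the left limit of `ψ` minus its value is in the polar of the tangent cone. -/
theorem sum_psi_jump_nonpos (h : IsStickyParticleSolution φ m xbar vbar x v) (hφ : IsProtocol φ)
    {a c : ℝ} (ha : 0 ≤ a) (hac : a < c) (hcoll : IsCollisionTime x c)
    (hfree : ∀ r ∈ Ioo a c, ¬ IsCollisionTime x r) {w : Fin N → ℝ}
    (hw : w ∈ feasibleCone (x c)) :
    ∑ i, m i * (psi φ m (x a) (v a) i - psi φ m (x c) (v c) i) * w i ≤ 0 := by
  obtain ⟨vm, hvm, hproj⟩ := h.collision c hcoll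
  have hc0 : 0 ≤ c := ha.trans hac.le
  have hxlim : Tendsto x (𝓝[<] c) (𝓝 (x c)) := by
    have h1 : Tendsto x (𝓝[Ici 0] c) (𝓝 (x c)) := h.cont c hc0
    refine h1.mono_left (nhdsWithin_le_of_mem ?_)
    filter_upwards [Ioo_mem_nhdsLT hac] with r hr
    exact ha.trans hr.1.le
  -- The convolution is continuous across the collision, so the jump of `ψ` is exactly the jump of
  -- `v`, that is, the residual of the projection.
  have hlim : Tendsto v (𝓝[<] c)
      (𝓝 (psi φ m (x a) (v a) - discreteConv φ m (x c))) := by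
    have h1 : Tendsto (fun r => psi φ m (x a) (v a) - discreteConv φ m (x r)) (𝓝[<] c)
        (𝓝 (psi φ m (x a) (v a) - discreteConv φ m (x c))) :=
      tendsto_const_nhds.sub (((continuous_discreteConv hφ m).tendsto _).comp hxlim)
    refine h1.congr' ?_
    filter_upwards [Ioo_mem_nhdsLT hac] with r hr
    rw [← h.psi_congr ha hr.1.le fun t ht => hfree t ⟨ht.1, ht.2.trans_lt hr.2⟩, psi_eq,
      add_sub_cancel_right]
  have hvm_eq : vm = psi φ m (x a) (v a) - discreteConv φ m (x c) :=
    tendsto_nhds_unique hvm hlim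
  have h1 := hproj.sum_nonpos_of_mem (h.ordered c hc0) hw
  refine le_of_eq_of_le (Finset.sum_congr rfl fun i _ => ?_) h1
  rw [hvm_eq, psi_eq φ m (x c)]
  simp only [Pi.add_apply, Pi.sub_apply]
  ring

/-- `ψ(s) - ψ(t)` is in the polar of the tangent cone at `x(t)`. -/
theorem sum_psi_sub_nonpos (h : IsStickyParticleSolution φ m xbar vbar x v) (hφ : IsProtocol φ)
    (hm : ∀ i, 0 < m i) (hxbar : StrictMono xbar) {s t : ℝ} (hs : 0 ≤ s) (hst : s ≤ t)
    {w : Fin N → ℝ} (hw : w ∈ feasibleCone (x t)) :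
    ∑ i, m i * (psi φ m (x s) (v s) i - psi φ m (x t) (v t) i) * w i ≤ 0 := by
  let S : ℝ → Set ℝ := fun r => {c | IsCollisionTime x c} ∩ Ioc s r
  have hfin : ∀ r, (S r).Finite := fun r => h.finite_coll.subset inter_subset_left
  -- Induction on the number of collisions in `(s, r]`. The last one, `c`, is split off at a time
  -- `a` close enough before it that `(a, c)` is free of collisions.
  have main : ∀ n : ℕ, ∀ r, s ≤ r → (S r).ncard = n → ∀ w ∈ feasibleCone (x r),
      ∑ i, m i * (psi φ m (x s) (v s) i - psi φ m (x r) (v r) i) * w i ≤ 0 := by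
    intro n
    induction n using Nat.strong_induction_on with
    | _ n ih =>
      intro r hsr hn w hw
      rcases (S r).eq_empty_or_nonempty with hS | hS
      · rw [h.psi_congr hs hsr fun c hc hcoll =>
          (hS ▸ (⟨hcoll, hc⟩ : c ∈ S r) : c ∈ (∅ : Set ℝ))]
        simp
      · obtain ⟨c, ⟨hcoll, hcI⟩, hmax⟩ := (hfin r).exists_maximalFor id _ hS
        have hmax' : ∀ c' ∈ S r, c' ≤ c := fun c' hc' => by
          by_contra hlt
          push Not at hlt
          exact absurd (hmax hc' hlt.le) (not_le.mpr hlt)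
        have hrc : psi φ m (x r) (v r) = psi φ m (x c) (v c) :=
          h.psi_congr (hs.trans hcI.1.le) hcI.2 fun c' hc' hcoll' =>
            absurd (hmax' c' ⟨hcoll', hcI.1.trans hc'.1, hc'.2⟩) (not_le.mpr hc'.1)
        obtain ⟨δ, hδ, hiso⟩ := h.exists_isolating c
        obtain ⟨a, ha, hac⟩ : ∃ a, max s (c - δ) < a ∧ a < c :=
          exists_between (max_lt hcI.1 (by linarith))
        rw [max_lt_iff] at ha
        have hlt : (S a).ncard < n := by
          rw [← hn]
          refine ncard_lt_ncard ?_ (hfin r)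
          refine ⟨fun c' hc' => ⟨hc'.1, hc'.2.1, hc'.2.2.trans (hac.le.trans hcI.2)⟩, fun hss => ?_⟩
          exact absurd (hss ⟨hcoll, hcI⟩).2.2 (not_le.mpr hac)
        have hwc := h.feasibleCone_anti hφ hm hxbar (hs.trans hcI.1.le) hcI.2 hw
        have hwa := h.feasibleCone_anti hφ hm hxbar (hs.trans ha.1.le) hac.le hwc
        have h1 := ih _ hlt a ha.1.le rfl w hwa
        have h2 := h.sum_psi_jump_nonpos hφ (hs.trans ha.1.le) hac hcoll (fun q hq hq' => by
          have := hiso q ⟨by linarith [hq.1, ha.2], by linarith [hq.2]⟩ hq'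
          linarith [hq.2]) hwc
        rw [hrc]
        refine le_of_eq_of_le ?_ (add_nonpos h1 h2)
        rw [← Finset.sum_add_distrib]
        exact Finset.sum_congr rfl fun i _ => by ring
  exact main _ t hst rfl w hw

theorem psi_constOnClusters (h : IsStickyParticleSolution φ m xbar vbar x v)
    (hm : ∀ i, 0 < m i) (hxbar : StrictMono xbar) {t : ℝ} (ht : 0 ≤ t) :
    ConstOnClusters (x t) (psi φ m (x t) (v t)) := fun i j he => by
  rw [psi_eq, Pi.add_apply, Pi.add_apply, h.velocity_constOnClusters hm hxbar ht i j he,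
    constOnClusters_discreteConv φ m (x t) i j he]

/-- Off the collision times the right derivative is a derivative. -/
theorem hasDerivAt (h : IsStickyParticleSolution φ m xbar vbar x v) (hφ : IsProtocol φ) {t : ℝ}
    (ht : 0 < t) (hcoll : ¬ IsCollisionTime x t) : HasDerivAt x (v t) t := by
  obtain ⟨δ, hδ, hiso⟩ := h.exists_isolating t
  obtain ⟨a, ha, hat⟩ : ∃ a, max 0 (t - δ) < a ∧ a < t :=
    exists_between (max_lt ht (by linarith))
  rw [max_lt_iff] at ha
  set b := t + δ / 2 with hb
  have hx : ContinuousOn x (Icc a b) := h.cont.mono fun s hs => ha.1.le.trans hs.1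
  -- Around `t` the vector `ψ` is constant, so `v` is a continuous function of the continuous `x`.
  -- The fundamental theorem then upgrades the right derivative.
  have hv : ContinuousOn v (Icc a b) := by
    have h1 : ContinuousOn (fun s => psi φ m (x a) (v a) - discreteConv φ m (x s)) (Icc a b) :=
      continuousOn_const.sub ((continuous_discreteConv hφ m).comp_continuousOn hx)
    refine h1.congr fun s hs => ?_
    beta_reduce
    rw [← h.psi_congr ha.1.le hs.1 fun r hr hcr => hcoll
      (hiso r ⟨by linarith [hr.1, ha.2], by linarith [hr.2, hs.2]⟩ hcr ▸ hcr), psi_eq,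
      add_sub_cancel_right]
  have hint : ∀ s ∈ Icc a b, IntervalIntegrable v volume a s := fun s hs =>
    (hv.mono (Icc_subset_Icc le_rfl hs.2)).intervalIntegrable_of_Icc hs.1
  have htI : t ∈ Ioo a b := ⟨hat, by linarith⟩
  have hFTC : ∀ s ∈ Icc a b, x s = x a + ∫ r in a..s, v r := by
    intro s hs
    rw [intervalIntegral.integral_eq_sub_of_hasDeriv_right_of_le hs.1
      (hx.mono (Icc_subset_Icc le_rfl hs.2))
      (fun r hr => (h.deriv_right r (ha.1.le.trans hr.1.le)).mono Ioi_subset_Ici_self)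
      (hint s hs), add_sub_cancel]
  have hvt : ContinuousAt v t := hv.continuousAt (Icc_mem_nhds htI.1 htI.2)
  have hd : HasDerivAt (fun s => x a + ∫ r in a..s, v r) (v t) t :=
    (intervalIntegral.integral_hasDerivAt_right (hint t (Ioo_subset_Icc_self htI))
      ((hv.mono Ioo_subset_Icc_self).stronglyMeasurableAtFilter isOpen_Ioo t htI) hvt).const_add
      (x a)
  refine hd.congr_of_eventuallyEq ?_
  filter_upwards [Icc_mem_nhds htI.1 htI.2] with s hs
  exact hFTC s hs

end IsStickyParticleSolution

end Dynamics

/-! ### Lifting to `L²(Ω)` -/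

section Lift

variable {N : ℕ} {m x : Fin N → ℝ}

theorem step_add (m a b : Fin N → ℝ) : step m (a + b) = step m a + step m b :=
  map_add (stepL m) a b

theorem step_sub (m a b : Fin N → ℝ) : step m (a - b) = step m a - step m b :=
  map_sub (stepL m) a b

theorem step_smul (m : Fin N → ℝ) (c : ℝ) (a : Fin N → ℝ) : step m (c • a) = c • step m a :=
  map_smul (stepL m) c a

theorem sub_mem_feasibleCone {z : Fin N → ℝ} (hz : Monotone z) : z - x ∈ feasibleCone x :=
  fun i j hij he => by simp only [Pi.sub_apply, he]; linarith [hz hij]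

theorem ConstOnClusters.mem_feasibleCone {a : Fin N → ℝ} (ha : ConstOnClusters x a) :
    a ∈ feasibleCone x := fun i j _ he => (ha i j he).le

/-- Testing against `Z ∈ 𝒦` is testing against its cell means, which form a monotone vector. -/
theorem step_mem_subdiff_indK (hm : ∀ i, 0 < m i) (hs : ∑ i, m i = 1) (hx : Monotone x)
    {n : Fin N → ℝ} (hn : ∀ z, Monotone z → ∑ i, m i * n i * (z i - x i) ≤ 0) :
    step m n ∈ subdiff indK (step m x) := by
  refine (mem_subdiff_indK (step_mem_coneK hm hs hx)).mpr fun Z hZ => ?_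
  rw [inner_sub_right, inner_step hm hs, inner_step_step hm hs, ← Finset.sum_sub_distrib]
  refine le_of_eq_of_le (Finset.sum_congr rfl fun i _ => ?_) (hn _ (cellMean_monotone hm hs hZ))
  ring

/-- The cell means of `U` are constant on clusters, so both they and their negatives are feasible
directions. The polar inequality becomes an equality. -/
theorem inner_step_eq_zero (hm : ∀ i, 0 < m i) (hs : ∑ i, m i = 1) (hx : Monotone x)
    {n : Fin N → ℝ} (hn : ∀ w ∈ feasibleCone x, ∑ i, m i * n i * w i ≤ 0) {U : L2Ω}
    (hU : U ∈ spaceH (step m x)) : inner ℝ (step m n) U = 0 := by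
  have hc := cellMean_constOnClusters hm hs hx hU
  rw [inner_step hm hs]
  refine le_antisymm (hn _ hc.mem_feasibleCone) ?_
  have h1 : ConstOnClusters x (-cellMean m U) := fun i j he => by
    simp only [Pi.neg_apply, hc i j he]
  have h2 := hn _ h1.mem_feasibleCone
  simp only [Pi.neg_apply, mul_neg, Finset.sum_neg_distrib] at h2
  linarith

theorem isMetricProj_spaceH (hm : ∀ i, 0 < m i) (hs : ∑ i, m i = 1) (hx : Monotone x)
    {n p : Fin N → ℝ} (hp : ConstOnClusters x p)
    (hn : ∀ w ∈ feasibleCone x, ∑ i, m i * n i * w i ≤ 0) {Z : L2Ω}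
    (hZ : Z - step m p = step m n) : IsMetricProj (spaceH (step m x)) Z (step m p) := by
  have hpH := step_mem_spaceH hm hs hx hp
  refine isMetricProj_of_inner_le hpH fun W hW => ?_
  rw [hZ, inner_sub_right, inner_step_eq_zero hm hs hx hn hW,
    inner_step_eq_zero hm hs hx hn hpH, sub_zero]

/-- `-V` is the minimal element of the subdifferential of the potential at `X` when `V` is constant
on the clusters and `Ψ̄ - Ψ[X,V]` is in the polar of the tangent cone at `X`. -/
theorem isMinimalElement_neg_step {φ : ℝ → ℝ} (hφ : IsProtocol φ) (hm : ∀ i, 0 < m i)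
    (hs : ∑ i, m i = 1) (hx : Monotone x) {v ψ₀ : Fin N → ℝ} (hv : ConstOnClusters x v)
    (hn : ∀ w ∈ feasibleCone x, ∑ i, m i * (ψ₀ - psi φ m x v) i * w i ≤ 0) :
    IsMinimalElement (subdiff (potentialK φ (step m ψ₀)) (step m x)) (-step m v) := by
  have hxK := step_mem_coneK hm hs hx
  constructor
  · refine (mem_subdiff_potentialK hxK).mpr fun Z hZ => ?_
    have h1 := potential_add_inner_le hφ (step m ψ₀) (step m x) Z
    have h2 := (mem_subdiff_indK hxK).mp (step_mem_subdiff_indK hm hs hx fun z hz =>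
      hn _ (sub_mem_feasibleCone hz)) Z hZ
    have h3 : -step m v = (PhiConv hφ (step m x) - step m ψ₀)
        + step m (ψ₀ - psi φ m x v) := by
      rw [PhiConv_step hφ hm hs, psi_eq, step_sub, step_add]
      abel
    rw [h3, inner_add_left]
    linarith
  · intro Y hY
    rw [mem_subdiff_potentialK hxK] at hY
    -- The subgradient inequality of `Y` at `X` is compared with the gradient inequality at `X +
    -- εV`, which stays in `𝒦` for small `ε`. As `ε → 0` this gives `⟨Y, V⟩ ≤ -‖V‖²`, because the
    -- residual is orthogonal to `V`. Cauchy–Schwarz concludes.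
    have hev : ∀ᶠ ε in 𝓝[>] (0 : ℝ), inner ℝ Y (step m v)
        ≤ ∑ i, m i * (discreteConv φ m (x + ε • v) - ψ₀) i * v i := by
      filter_upwards [eventually_monotone_add_smul hx hv.mem_feasibleCone, self_mem_nhdsWithin]
        with ε hmono hε
      have hε' : 0 < ε := hε
      have h1 := hY _ (step_mem_coneK hm hs hmono)
      have h2 := potential_add_inner_le hφ (step m ψ₀) (step m (x + ε • v)) (step m x)
      have h3 : step m x - step m (x + ε • v) = -(ε • step m v) := by
        rw [step_add, step_smul]; abel
      have h4 : step m (x + ε • v) - step m x = ε • step m v := by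
        rw [step_add, step_smul]; abel
      rw [h4, real_inner_smul_right] at h1
      rw [h3, PhiConv_step hφ hm hs, ← step_sub, inner_neg_right, real_inner_smul_right,
        inner_step_step hm hs] at h2
      refine le_of_mul_le_mul_left (a := ε) ?_ hε'
      linarith
    have hcont : Continuous fun ε : ℝ =>
        ∑ i, m i * (discreteConv φ m (x + ε • v) - ψ₀) i * v i := by
      have := continuous_discreteConv hφ m
      fun_prop
    have hlim := (hcont.tendsto 0).mono_left (nhdsWithin_le_nhds (s := Ioi 0))
    have hle := ge_of_tendsto hlim hev
    have hval : ∑ i, m i * (discreteConv φ m (x + (0 : ℝ) • v) - ψ₀) i * v i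
        = -‖step m v‖ ^ 2 := by
      have h0 := inner_step_eq_zero hm hs hx hn (step_mem_spaceH hm hs hx hv)
      rw [← real_inner_self_eq_norm_sq, ← inner_step_step hm hs, zero_smul, add_zero]
      have h5 : discreteConv φ m x - ψ₀ = -v - (ψ₀ - psi φ m x v) := by
        rw [psi_eq]; abel
      rw [h5, step_sub, inner_sub_left, h0, sub_zero, ← inner_neg_left]
      congr 1
      exact map_neg (stepL m) v
    rw [hval] at hle
    have hCS := abs_le.mp (abs_real_inner_le_norm Y (step m v))
    rw [norm_neg]
    by_contra hlt
    push Not at hlt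
    have hpos : 0 < ‖step m v‖ := (norm_nonneg Y).trans_lt hlt
    nlinarith [mul_lt_mul_of_pos_right hlt hpos, hCS.1]

end Lift

/-! ### Regularity of the lifted curve and the position formula -/

section Solution

variable {φ : ℝ → ℝ} {N : ℕ} {m xbar vbar : Fin N → ℝ} {x v : ℝ → Fin N → ℝ}

namespace IsStickyParticleSolution

theorem hasDerivWithinAt_step (h : IsStickyParticleSolution φ m xbar vbar x v) {t : ℝ}
    (ht : 0 ≤ t) : HasDerivWithinAt (fun s => step m (x s)) (step m (v t)) (Ici t) t :=
  (stepL m).hasFDerivAt.comp_hasDerivWithinAt t (h.deriv_right t ht)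

theorem ae_hasDerivAt_step (h : IsStickyParticleSolution φ m xbar vbar x v)
    (hφ : IsProtocol φ) : ∀ᵐ t ∂volume.restrict (Ioi (0 : ℝ)),
      0 < t ∧ HasDerivAt (fun s => step m (x s)) (step m (v t)) t := by
  have h1 : ∀ᵐ t ∂volume.restrict (Ioi (0 : ℝ)), t ∉ {r | IsCollisionTime x r} :=
    ae_restrict_of_ae (measure_eq_zero_iff_ae_notMem.mp (h.finite_coll.measure_zero volume))
  filter_upwards [h1, ae_restrict_mem measurableSet_Ioi] with t ht ht0
  exact ⟨ht0, (stepL m).hasFDerivAt.comp_hasDerivAt t (h.hasDerivAt hφ ht0 ht)⟩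

theorem isMetricProj_psi (h : IsStickyParticleSolution φ m xbar vbar x v) (hφ : IsProtocol φ)
    (hm : ∀ i, 0 < m i) (hs : ∑ i, m i = 1) (hxbar : StrictMono xbar) {s t : ℝ} (hs0 : 0 ≤ s)
    (hst : s ≤ t) : IsMetricProj (spaceH (step m (x t))) (step m (psi φ m (x s) (v s)))
      (step m (psi φ m (x t) (v t))) :=
  isMetricProj_spaceH hm hs (h.ordered t (hs0.trans hst))
    (h.psi_constOnClusters hm hxbar (hs0.trans hst))
    (fun _ hw => h.sum_psi_sub_nonpos hφ hm hxbar hs0 hst hw) (step_sub _ _ _).symm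

/-- `Ψ_t` is an orthogonal projection of `Ψ_0`, hence no longer than it. -/
theorem norm_step_psi_le (h : IsStickyParticleSolution φ m xbar vbar x v) (hφ : IsProtocol φ)
    (hm : ∀ i, 0 < m i) (hs : ∑ i, m i = 1) (hxbar : StrictMono xbar) {t : ℝ} (ht : 0 ≤ t) :
    ‖step m (psi φ m (x t) (v t))‖ ≤ ‖step m (psi φ m (x 0) (v 0))‖ := by
  have hx := h.ordered t ht
  have h0 := inner_step_eq_zero hm hs hx
    (n := psi φ m (x 0) (v 0) - psi φ m (x t) (v t))
    (fun w hw => h.sum_psi_sub_nonpos hφ hm hxbar le_rfl ht hw)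
    (step_mem_spaceH hm hs hx (h.psi_constOnClusters hm hxbar ht))
  rw [step_sub, inner_sub_left, real_inner_self_eq_norm_sq, sub_eq_zero] at h0
  have hCS := real_inner_le_norm (step m (psi φ m (x 0) (v 0))) (step m (psi φ m (x t) (v t)))
  rw [h0, sq] at hCS
  by_contra hlt
  push Not at hlt
  have := mul_lt_mul_of_pos_right hlt ((norm_nonneg _).trans_lt hlt)
  linarith

theorem continuousOn_step_discreteConv (h : IsStickyParticleSolution φ m xbar vbar x v)
    (hφ : IsProtocol φ) : ContinuousOn (fun r => step m (discreteConv φ m (x r))) (Ici 0) :=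
  ((stepL m).continuous.comp (continuous_discreteConv hφ m)).comp_continuousOn h.cont

/-- The velocity is `Ψ` minus the force. The first is bounded by its initial norm and the second by
compactness, so the curve is Lipschitz on `[0, T]` even across collisions. -/
theorem absolutelyContinuousOnInterval_step (h : IsStickyParticleSolution φ m xbar vbar x v)
    (hφ : IsProtocol φ) (hm : ∀ i, 0 < m i) (hs : ∑ i, m i = 1) (hxbar : StrictMono xbar) {T : ℝ}
    (hT : 0 < T) : AbsolutelyContinuousOnInterval (fun s => step m (x s)) 0 T := by
  obtain ⟨C, hC⟩ := isCompact_Icc.exists_bound_of_continuousOn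
    ((h.continuousOn_step_discreteConv hφ).mono (fun s (hs : s ∈ Icc 0 T) => hs.1))
  set K := ‖step m (psi φ m (x 0) (v 0))‖ + C with hK
  have hbound : ∀ t ∈ Icc 0 T, ‖step m (v t)‖ ≤ K := by
    intro t ht
    have h1 : v t = psi φ m (x t) (v t) - discreteConv φ m (x t) := by
      rw [psi_eq, add_sub_cancel_right]
    rw [h1, step_sub]
    exact (norm_sub_le _ _).trans (add_le_add (h.norm_step_psi_le hφ hm hs hxbar ht.1) (hC t ht))
  have hcont : ContinuousOn (fun s => step m (x s)) (Ici 0) :=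
    (stepL m).continuous.comp_continuousOn h.cont
  have hlip : LipschitzOnWith K.toNNReal (fun s => step m (x s)) (uIcc 0 T) := by
    rw [uIcc_of_le hT.le]
    have key : ∀ a ∈ Icc 0 T, ∀ b ∈ Icc 0 T, a ≤ b →
        ‖step m (x b) - step m (x a)‖ ≤ K * (b - a) := by
      intro a ha b hb hab
      exact norm_image_sub_le_of_norm_deriv_right_le_segment
        (hcont.mono fun s hs => ha.1.trans hs.1)
        (fun s hs => h.hasDerivWithinAt_step (ha.1.trans hs.1))
        (fun s hs => hbound s ⟨ha.1.trans hs.1, hs.2.le.trans hb.2⟩) b (right_mem_Icc.mpr hab)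
    refine LipschitzOnWith.of_dist_le_mul fun a ha b hb => ?_
    have hKn : 0 ≤ K := (norm_nonneg _).trans (hbound a ha)
    rw [Real.coe_toNNReal K hKn, dist_eq_norm, Real.dist_eq]
    rcases le_total a b with hab | hab
    · rw [norm_sub_rev, abs_sub_comm, abs_of_nonneg (sub_nonneg.mpr hab)]
      exact key a ha b hb hab
    · rw [abs_of_nonneg (sub_nonneg.mpr hab)]
      exact key b hb a ha hab
  exact hlip.absolutelyContinuousOnInterval

/-- The projection formula for the positions. -/
theorem isMetricProj_position (h : IsStickyParticleSolution φ m xbar vbar x v)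
    (hφ : IsProtocol φ) (hm : ∀ i, 0 < m i) (hs : ∑ i, m i = 1) (hxbar : StrictMono xbar)
    {s t : ℝ} (hs0 : 0 ≤ s) (hst : s ≤ t) :
    IsMetricProj coneK (step m (x s) + (t - s) • step m (psi φ m (x s) (v s))
      - ∫ r in s..t, step m (discreteConv φ m (x r))) (step m (x t)) := by
  have ht0 := hs0.trans hst
  have hxt := h.ordered t ht0
  -- Freezing the curve at negative times gives a globally continuous integrand and leaves times `r
  -- ≥ 0` unchanged.
  have hy : Continuous fun r => x (max r 0) :=
    h.cont.comp_continuous (by fun_prop) fun r => le_max_right r 0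
  have hc : Continuous fun r => discreteConv φ m (x (max r 0)) :=
    (continuous_discreteConv hφ m).comp hy
  have hmax : ∀ {r : ℝ}, s ≤ r → max r 0 = r := fun hr => max_eq_left (hs0.trans hr)
  have hint : ∫ r in s..t, step m (discreteConv φ m (x r))
      = step m (∫ r in s..t, discreteConv φ m (x (max r 0))) := by
    refine Eq.trans (intervalIntegral.integral_congr fun r hr => ?_)
      ((stepL m).intervalIntegral_comp_comm (hc.intervalIntegrable s t))
    rw [uIcc_of_le hst] at hr
    simp only [hmax hr.1, stepL_apply]
  refine isMetricProj_coneK_of_mem_subdiff (step_mem_coneK hm hs hxt) ?_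
  rw [hint, ← step_smul, ← step_add, ← step_sub, ← step_sub]
  refine step_mem_subdiff_indK hm hs hxt fun z hz => ?_
  set w := z - x t with hw
  have hwt : w ∈ feasibleCone (x t) := sub_mem_feasibleCone hz
  let q : (Fin N → ℝ) →L[ℝ] ℝ :=
    ∑ i, (m i * w i) • ContinuousLinearMap.proj (R := ℝ) (φ := fun _ : Fin N => ℝ) i
  have hq : ∀ n : Fin N → ℝ, q n = ∑ i, m i * n i * w i := fun n => by
    simp only [q, _root_.sum_apply, _root_.smul_apply,
      ContinuousLinearMap.proj_apply, smul_eq_mul]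
    exact Finset.sum_congr rfl fun i _ => by ring
  -- `f` is the residual at time `r` and vanishes at `s`. Its right derivative is `ψ(s) - ψ(r)`,
  -- which pairs nonpositively with the fixed direction `w`, since a direction feasible at `t` is
  -- feasible at `r ≤ t`.
  let f : ℝ → Fin N → ℝ := fun r => x s + (r - s) • psi φ m (x s) (v s)
    - (∫ r in s..r, discreteConv φ m (x (max r 0))) - x r
  have hf : ∀ r ∈ Ico s t, HasDerivWithinAt f
      (psi φ m (x s) (v s) - psi φ m (x r) (v r)) (Ici r) r := by
    intro r hr
    have h1 : HasDerivAt (fun r => x s + (r - s) • psi φ m (x s) (v s))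
        (psi φ m (x s) (v s)) r := by
      simpa using (((hasDerivAt_id r).sub_const s).smul_const
        (psi φ m (x s) (v s))).const_add (x s)
    have h2 := (hc.integral_hasStrictDerivAt s r).hasDerivAt
    have h3 := (h1.sub h2).hasDerivWithinAt.sub (h.deriv_right r (hs0.trans hr.1))
    have he : psi φ m (x s) (v s) - psi φ m (x r) (v r)
        = psi φ m (x s) (v s) - discreteConv φ m (x (max r 0)) - v r := by
      rw [hmax hr.1, psi_eq φ m (x r)]
      abel
    rw [he]
    exact h3
  have hfc : ContinuousOn f (Icc s t) := by
    have h1 : Continuous fun r => ∫ r in s..r, discreteConv φ m (x (max r 0)) :=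
      intervalIntegral.continuous_primitive (fun a b => hc.intervalIntegrable a b) s
    have h2 : Continuous fun r : ℝ => x s + (r - s) • psi φ m (x s) (v s) := by fun_prop
    exact (h2.sub h1).continuousOn.sub (h.cont.mono fun r hr => hs0.trans hr.1)
  have hmain := image_le_of_deriv_right_le_deriv_boundary (a := s) (b := t)
    (f := fun r => q (f r)) (f' := fun r => q (psi φ m (x s) (v s) - psi φ m (x r) (v r)))
    (B := fun _ => 0) (B' := fun _ => 0) (q.continuous.comp_continuousOn hfc)
    (fun r hr => q.hasFDerivAt.comp_hasDerivWithinAt r (hf r hr))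
    (by simp [f]) continuousOn_const (fun _ _ => hasDerivWithinAt_const _ _ _)
    (fun r hr => by
      rw [hq]
      exact h.sum_psi_sub_nonpos hφ hm hxbar hs0 hr.1
        (h.feasibleCone_anti hφ hm hxbar (hs0.trans hr.1) hr.2.le hwt))
  have hfin := hmain (right_mem_Icc.mpr hst)
  rw [hq] at hfin
  exact hfin

end IsStickyParticleSolution

end Solution

end StickyParticles

end

/-- Sticky particle solutions are sticky Lagrangian solutions and satisfy the projection formulas. -/
theorem mainTheorem8 {φ : ℝ → ℝ} (hφ : IsProtocol φ) {N : ℕ}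
    (m xbar vbar : Fin N → ℝ)
    (hm : ∀ i, 0 < m i) (hm_sum : ∑ i, m i = 1) (hxbar : StrictMono xbar)
    (x v : ℝ → Fin N → ℝ) (hxv : IsStickyParticleSolution φ m xbar vbar x v)
    (X V Ψ : ℝ → L2Ω) (hX : ∀ t, X t = step m (x t)) (hV : ∀ t, V t = step m (v t))
    (hΨ : ∀ t, Ψ t = PsiOf hφ (X t) (V t))
    (Ψbar : L2Ω) (hΨbar : Ψbar = PsiOf hφ (step m xbar) (step m vbar)) :
    IsStickyLagrangianSolution hφ (step m xbar) (step m vbar) X ∧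
    -- the differential inclusion, almost everywhere, and everywhere with the right derivative
    (∀ᵐ t ∂volume.restrict (Ioi (0 : ℝ)), ∃ D : L2Ω, HasDerivAt X D t ∧
      UOf hφ Ψbar (X t) - D ∈ subdiff indK (X t)) ∧
    (∀ t, 0 ≤ t → HasDerivWithinAt X (V t) (Ici t) t ∧
      UOf hφ Ψbar (X t) - V t ∈ subdiff indK (X t)) ∧
    -- the projection formulas
    (∀ t, 0 ≤ t → V t ∈ spaceH (X t) ∧ Ψ t ∈ spaceH (X t)) ∧
    (∀ s t, 0 ≤ s → s ≤ t →
      Ψ s - Ψ t ∈ subdiff indK (X t) ∧ IsMetricProj (spaceH (X t)) (Ψ s) (Ψ t) ∧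
      IntervalIntegrable (fun r => PhiConv hφ (X r)) volume s t ∧
      IsMetricProj coneK (X s + (t - s) • Ψ s - ∫ r in s..t, PhiConv hφ (X r)) (X t)) ∧
    (∀ t, 0 ≤ t →
      IsMetricProj (spaceH (X t)) (UOf hφ Ψbar (X t)) (V t) ∧
      IsMetricProj (spaceH (X t)) Ψbar (V t + PhiConv hφ (X t)) ∧
      IntervalIntegrable (fun r => UOf hφ Ψbar (X r)) volume 0 t ∧
      IsMetricProj coneK (step m xbar + ∫ r in (0 : ℝ)..t, UOf hφ Ψbar (X r)) (X t) ∧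
      IsMetricProj coneK
        (step m xbar + t • Ψbar - ∫ r in (0 : ℝ)..t, PhiConv hφ (X r)) (X t)) := by
  obtain rfl : X = fun t => step m (x t) := funext hX
  obtain rfl : V = fun t => step m (v t) := funext hV
  have hPsiOf : ∀ y u : Fin N → ℝ, PsiOf hφ (step m y) (step m u) = step m (psi φ m y u) :=
    fun y u => by rw [PsiOf, PhiConv_step hφ hm hm_sum, psi_eq, step_add]
  obtain rfl : Ψ = fun t => step m (psi φ m (x t) (v t)) :=
    funext fun t => (hΨ t).trans (hPsiOf _ _)
  rw [hPsiOf, ← hxv.init_pos, ← hxv.init_vel] at hΨbar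
  subst hΨbar
  have hinit : step m xbar = step m (x 0) := by rw [hxv.init_pos]
  have hPsi : ∀ t, step m (v t) + PhiConv hφ (step m (x t)) = step m (psi φ m (x t) (v t)) :=
    fun t => hPsiOf (x t) (v t)
  -- The force cancels, leaving `Ψ̄ - Ψ_t`. The statements about `V` are therefore those about `Ψ`
  -- with `s = 0`.
  have hUV : ∀ t, UOf hφ (step m (psi φ m (x 0) (v 0))) (step m (x t)) - step m (v t)
      = step m (psi φ m (x 0) (v 0)) - step m (psi φ m (x t) (v t)) := fun t => by
    rw [← hPsi t, UOf]
    abel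
  have hincl : ∀ s t, 0 ≤ s → s ≤ t →
      step m (psi φ m (x s) (v s)) - step m (psi φ m (x t) (v t))
        ∈ subdiff indK (step m (x t)) := fun s t hs hst => by
    rw [← step_sub]
    exact step_mem_subdiff_indK hm hm_sum (hxv.ordered t (hs.trans hst)) fun z hz =>
      hxv.sum_psi_sub_nonpos hφ hm hxbar hs hst (sub_mem_feasibleCone hz)
  have hvH : ∀ t, 0 ≤ t → step m (v t) ∈ spaceH (step m (x t)) := fun t ht =>
    step_mem_spaceH hm hm_sum (hxv.ordered t ht) (hxv.velocity_constOnClusters hm hxbar ht)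
  have hint : ∀ s t, 0 ≤ s → s ≤ t →
      IntervalIntegrable (fun r => PhiConv hφ (step m (x r))) volume s t := fun s t hs hst => by
    simp only [PhiConv_step hφ hm hm_sum]
    exact ((hxv.continuousOn_step_discreteConv hφ).mono
      fun r hr => hs.trans hr.1).intervalIntegrable_of_Icc hst
  have hpos : ∀ s t, 0 ≤ s → s ≤ t →
      IsMetricProj coneK (step m (x s) + (t - s) • step m (psi φ m (x s) (v s))
        - ∫ r in s..t, PhiConv hφ (step m (x r))) (step m (x t)) := fun s t hs hst => by
    simp only [PhiConv_step hφ hm hm_sum]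
    exact hxv.isMetricProj_position hφ hm hm_sum hxbar hs hst
  refine ⟨⟨⟨hinit.symm, fun t ht => step_mem_coneK hm hm_sum (hxv.ordered t ht),
      fun T hT => hxv.absolutelyContinuousOnInterval_step hφ hm hm_sum hxbar hT, ?_⟩,
      fun s t hs hst => OmegaSet_step_subset hm hm_sum (hxv.ordered s hs)
        (hxv.sticky hφ hm hxbar hs hst)⟩,
    ?_, fun t ht => ⟨hxv.hasDerivWithinAt_step ht, ?_⟩,
    fun t ht => ⟨hvH t ht, (hxv.isMetricProj_psi hφ hm hm_sum hxbar le_rfl ht).1⟩,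
    fun s t hs hst => ⟨hincl s t hs hst, hxv.isMetricProj_psi hφ hm hm_sum hxbar hs hst,
      hint s t hs hst, hpos s t hs hst⟩,
    fun t ht => ⟨?_, ?_, ?_, ?_, ?_⟩⟩
  · filter_upwards [hxv.ae_hasDerivAt_step hφ] with t ht
    refine ⟨_, ht.2, ?_⟩
    rw [hPsiOf, ← hxv.init_pos, ← hxv.init_vel]
    exact isMinimalElement_neg_step hφ hm hm_sum (hxv.ordered t ht.1.le)
      (hxv.velocity_constOnClusters hm hxbar ht.1.le)
      fun w hw => hxv.sum_psi_sub_nonpos hφ hm hxbar le_rfl ht.1.le hw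
  · filter_upwards [hxv.ae_hasDerivAt_step hφ] with t ht
    exact ⟨_, ht.2, by rw [hUV]; exact hincl 0 t le_rfl ht.1.le⟩
  · rw [hUV]
    exact hincl 0 t le_rfl ht
  · exact isMetricProj_spaceH hm hm_sum (hxv.ordered t ht)
      (hxv.velocity_constOnClusters hm hxbar ht)
      (fun w hw => hxv.sum_psi_sub_nonpos hφ hm hxbar le_rfl ht hw)
      ((hUV t).trans (step_sub _ _ _).symm)
  · rw [hPsi]
    exact hxv.isMetricProj_psi hφ hm hm_sum hxbar le_rfl ht
  · exact intervalIntegrable_const.sub (hint 0 t le_rfl ht)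
  · have h := hpos 0 t le_rfl ht
    simp only [UOf]
    rw [intervalIntegral.integral_sub intervalIntegrable_const (hint 0 t le_rfl ht),
      intervalIntegral.integral_const, hinit, ← add_sub_assoc]
    exact h
  · have h := hpos 0 t le_rfl ht
    rw [sub_zero] at h
    rw [hinit]
    exact h
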